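/- Let $f_\nu$ be the Student $t$ density with $\nu$ degrees of freedom and let $$m(\gamma,\nu)=\frac{2\nu\,\Gamma(\frac{\nu+1}{2})}{\sqrt{\pi\nu}\,(\nu-1)\,\Gamma(\frac{\nu}{2})}\Big(\gamma-\frac1\gamma\Big).$$ For $\gamma>0$, $\nu>2$, the centred two-piece Student $t$ distribution $\mathrm{ctpt}(\gamma,\nu)$ has density $$p(\varepsilon\mid\gamma,\nu)=\frac{2}{\gamma+1/\gamma}\Big[f_\nu\big(\tfrac{\varepsilon+m(\gamma,\nu)}{\gamma}\big)I_{[-m(\gamma,\nu),\infty)}(\varepsilon)+f_\nu\big(\gamma(\varepsilon+m(\gamma,\nu))\big)I_{(-\infty,-m(\gamma,\nu))}(\varepsilon)\Big].$$ Let $X=[x_1,\dots,x_n]^T$ be a real $n\times k$ matrix of full column rank $k$. Consider the model $y_i=x_i^T\beta+\sigma\varepsilon_i$, $i=1,\dots,n$, with $\beta\in\mathbb R^k$, $\sigma>0$ and $\varepsilon_i$ i.i.d. $\mathrm{ctpt}(\gamma,\nu)$, under the (improper) prior $\sigma^{-1}\,d\beta\,d\sigma\,P_\gamma(d\gamma)\,P_\nu(d\nu)$.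 Here $P_\gamma$ is a probability measure on some interval $[a,b]$ with $0<a\le1\le b<\infty$, and $P_\nu$ is a probability measure on $(2,\infty)$. The posterior given $y\in\mathbb R^n$ is proper if the integral of the likelihood against the prior is positive and finite; the posterior is then the normalised product of likelihood and prior, and $E(\cdot\mid y)$ is expectation under it. For a column $j$, the singularity index $p_j$ is the largest integer $p$, $0\le p\le n-k$, such that some $k-1+p$ rows of $X$ form a submatrix of rank $k-1$ whose rank is still $k-1$ after its $j$th column is removed. (a) For every $y$ not in the column space of $X$ and all such $P_\gamma,P_\nu$ for which the posterior is proper, $E(|\beta_j|^r\mid y)=\infty$ for all $j$ and all real $r\ge n-k$. (b) For Lebesgue-almost every $y\in\mathbb R^n$ (the exceptional null set depending only on $X$), if $y$ is not in the column space of $X$, then for all such $P_\gamma,P_\nu$ the posterior is proper, and $E(|\beta_j|^r\mid y)<\infty$ for all $j$ and all real $r$ with $0\le r<\min\{n-k,\;n-k-p_j+2\}$. -/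

import Mathlib

open MeasureTheory Set

noncomputable section

/-- The density of the Student `t` distribution with `ν` degrees of freedom. -/
def studentPDF (ν x : ℝ) : ℝ :=
  Real.Gamma ((ν + 1) / 2) / (Real.sqrt (Real.pi * ν) * Real.Gamma (ν / 2)) *
    (1 + x ^ 2 / ν) ^ (-((ν + 1) / 2))

/-- The mean of the (uncentred) two-piece Student `t` distribution. -/
def twoPieceMean (γ ν : ℝ) : ℝ :=
  2 * ν * Real.Gamma ((ν + 1) / 2) /
    (Real.sqrt (Real.pi * ν) * (ν - 1) * Real.Gamma (ν / 2)) * (γ - 1 / γ)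

/-- The density of the centred two-piece Student `t` distribution `ctpt(γ, ν)`. -/
def ctptPDF (γ ν ε : ℝ) : ℝ :=
  2 / (γ + 1 / γ) *
    if -twoPieceMean γ ν ≤ ε then studentPDF ν ((ε + twoPieceMean γ ν) / γ)
    else studentPDF ν (γ * (ε + twoPieceMean γ ν))

/-- The likelihood of `y` in the linear model `y i = (X β) i + σ ε i`, where the `ε i` are
independent with law `ctpt(γ, ν)`. The parameter is `θ = (β, σ, γ, ν)`. -/
def ctptLikelihood {n k : ℕ} (X : Matrix (Fin n) (Fin k) ℝ) (y : Fin n → ℝ)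
    (θ : (Fin k → ℝ) × ℝ × ℝ × ℝ) : ℝ :=
  ∏ i, θ.2.1⁻¹ * ctptPDF θ.2.2.1 θ.2.2.2 ((y i - X.mulVec θ.1 i) / θ.2.1)

/-- The improper prior of the scale, with density `1 / σ` on `(0, ∞)`. -/
def scalePrior : Measure ℝ :=
  (volume.restrict (Ioi 0)).withDensity fun σ => ENNReal.ofReal σ⁻¹

/-- The prior of `(β, σ, γ, ν)`: the product of Lebesgue measure, `dσ / σ`, `Pγ` and `Pν`. -/
def ctptPrior (k : ℕ) (Pγ Pν : Measure ℝ) : Measure ((Fin k → ℝ) × ℝ × ℝ × ℝ) :=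
  (volume : Measure (Fin k → ℝ)).prod (scalePrior.prod (Pγ.prod Pν))

/-- `P` is a proper distribution on an interval `[a, b]` with `0 < a ≤ 1 ≤ b < ∞`. -/
def IsSkewnessPrior (P : Measure ℝ) : Prop :=
  IsProbabilityMeasure P ∧ ∃ a b : ℝ, 0 < a ∧ a ≤ 1 ∧ 1 ≤ b ∧ P (Icc a b) = 1

/-- `P` is a proper distribution on `(2, ∞)`. -/
def IsTailPrior (P : Measure ℝ) : Prop :=
  IsProbabilityMeasure P ∧ P (Ioi 2) = 1

/-- The integral of the likelihood against the prior. -/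
def marginalLikelihood {n k : ℕ} (X : Matrix (Fin n) (Fin k) ℝ) (y : Fin n → ℝ)
    (Pγ Pν : Measure ℝ) : ENNReal :=
  ∫⁻ θ, ENNReal.ofReal (ctptLikelihood X y θ) ∂(ctptPrior k Pγ Pν)

/-- The posterior is proper: the likelihood times the prior can be normalised. -/
def PosteriorProper {n k : ℕ} (X : Matrix (Fin n) (Fin k) ℝ) (y : Fin n → ℝ)
    (Pγ Pν : Measure ℝ) : Prop :=
  0 < marginalLikelihood X y Pγ Pν ∧ marginalLikelihood X y Pγ Pν < ⊤

/-- The posterior distribution of `(β, σ, γ, ν)` given `y`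
(meaningful when the posterior is proper). -/
def ctptPosterior {n k : ℕ} (X : Matrix (Fin n) (Fin k) ℝ) (y : Fin n → ℝ)
    (Pγ Pν : Measure ℝ) : Measure ((Fin k → ℝ) × ℝ × ℝ × ℝ) :=
  (marginalLikelihood X y Pγ Pν)⁻¹ •
    (ctptPrior k Pγ Pν).withDensity fun θ => ENNReal.ofReal (ctptLikelihood X y θ)

/-- The posterior moment `E(|β j| ^ r | y)`, a value in `[0, ∞]`. -/
def posteriorAbsMoment {n k : ℕ} (X : Matrix (Fin n) (Fin k) ℝ) (y : Fin n → ℝ)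
    (Pγ Pν : Measure ℝ) (j : Fin k) (r : ℝ) : ENNReal :=
  ∫⁻ θ, ENNReal.ofReal (|θ.1 j| ^ r) ∂(ctptPosterior X y Pγ Pν)

/-- There are `k - 1 + p` rows of `X` which form a matrix of rank `k - 1` that still has rank
`k - 1` after its column `j` is removed. -/
def HasSingularRows {n k : ℕ} (X : Matrix (Fin n) (Fin k) ℝ) (j : Fin k) (p : ℕ) : Prop :=
  ∃ S : Finset (Fin n), S.card = k - 1 + p ∧
    (X.submatrix (fun i : S => (i : Fin n)) id).rank = k - 1 ∧
    (X.submatrix (fun i : S => (i : Fin n)) (fun l : {l : Fin k // l ≠ j} => (l : Fin k))).rank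
      = k - 1

/-- The singularity index of column `j`: the largest `p` with `0 ≤ p ≤ n - k` such that `X` has
`k - 1 + p` rows as in `HasSingularRows`. -/
def singularityIndex {n k : ℕ} (X : Matrix (Fin n) (Fin k) ℝ) (j : Fin k) : ℕ :=
  sSup {p : ℕ | p ≤ n - k ∧ HasSingularRows X j p}

end

/-! Upper bounds. Uniformly over `γ ∈ [a, b]` and `ν > 2` the error density is at most a constant
times `(1 + |ε|) ^ (-3)` (`exists_ctptPDF_le_powerTail`), so finiteness reduces to a model with
cubic tails in which `γ` and `ν` no longer occur. There `∫∫ W(β) L(β, σ) dβ dσ/σ`, with `W = |β_j| ^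
r`, is split at `σ = 1`. For `σ > 1`, the substitution `β = σ b` leaves `σ ^ (r - n + k - 1)`,
integrable at infinity because `r < n - k`, times `K = ∫ W(b) ∏ (1 + |(X b)_i|) ^ (-a) db`. For `σ ≤
1`, the integral is averaged over `y` against a weight containing a small power `s` of the distance
from `y` to the column space. Some residual is at least that distance, so lowering the tail exponent
by `s` buys a factor `σ ^ s`, which makes `dσ/σ` integrable at 0; integrating out `y` then leaves
`K` again. Tonelli gives finiteness for almost every `y` off the column space.

`K` is finite by a greedy choice of basis (`exists_moment_mul_prod_powerTail_le`). Given `b`, take a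
row basis `A` of `X` minimising the sum of the `|(X b)_i|` over its rows. Some dual vector `d`
(column `l` of `A⁻¹`, with `d_j ≠ 0`) has `|b_j| ≲ |(A b)_l|`, and by minimality every row not
orthogonal to `d` has `|(X b)_i| ≥ |(A b)_l|`. The rows orthogonal to `d` have rank `k - 1` even
without column `j`, so there are at most `k - 1 + p_j` of them. Hence at least `n - k + 1 - p_j`
factors decay in the coordinate `(A b)_l`, and `K` is finite once `r + 1 < a (n - k + 1 - p_j)`. For
`a` close to 3 this covers `r < n - k - p_j + 2`, since `p_j ≤ n - k`.

Divergence. Where `σ` is large and all `β_l` are small multiples of `σ`, the standardised residuals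
stay in `[-1, 1]` and the density is bounded below. The moment integral then dominates `∫ σ ^ (r + k
- n - 1) dσ`, which diverges for `r ≥ n - k`. -/

/-! ### The kernel `(1 + |x|) ^ (-a)`. -/

/-- The heavy-tailed kernel `(1 + |x|) ^ (-a)`. -/
noncomputable def powerTail (a x : ℝ) : ℝ := (1 + |x|) ^ (-a)

lemma powerTail_pos (a x : ℝ) : 0 < powerTail a x := by
  unfold powerTail; positivity

lemma powerTail_nonneg (a x : ℝ) : 0 ≤ powerTail a x := (powerTail_pos a x).le

lemma powerTail_le_one {a : ℝ} (ha : 0 ≤ a) (x : ℝ) : powerTail a x ≤ 1 :=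
  Real.rpow_le_one_of_one_le_of_nonpos (by linarith [abs_nonneg x]) (by linarith)

lemma powerTail_anti_abs {a : ℝ} (ha : 0 ≤ a) {x y : ℝ} (h : |x| ≤ |y|) :
    powerTail a y ≤ powerTail a x :=
  Real.rpow_le_rpow_of_nonpos (by positivity) (by linarith) (by linarith)

lemma powerTail_anti_exponent {a a' : ℝ} (h : a ≤ a') (x : ℝ) :
    powerTail a' x ≤ powerTail a x :=
  Real.rpow_le_rpow_of_exponent_le (by linarith [abs_nonneg x]) (by linarith)

lemma powerTail_mul_powerTail (a a' x : ℝ) :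
    powerTail a x * powerTail a' x = powerTail (a + a') x := by
  unfold powerTail
  rw [← Real.rpow_add (by positivity)]; ring_nf

lemma powerTail_neg (x : ℝ) (a : ℝ) : powerTail (-a) x = (1 + |x|) ^ a := by
  simp [powerTail]

/-- Comes from `1 + |x + y| ≤ (1 + |x|) (1 + |y|)`. It allows a translation of the kernel to be paid
for by a factor depending on the shift alone. -/
lemma powerTail_mul_powerTail_le {a : ℝ} (ha : 0 ≤ a) (x y : ℝ) :
    powerTail a x * powerTail a y ≤ powerTail a (x + y) := by
  unfold powerTail
  rw [← Real.mul_rpow (by positivity) (by positivity)]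
  refine Real.rpow_le_rpow_of_nonpos (by positivity) ?_ (by linarith)
  nlinarith [abs_add_le x y, abs_nonneg x, abs_nonneg y, mul_nonneg (abs_nonneg x) (abs_nonneg y)]

@[fun_prop]
lemma measurable_powerTail (a : ℝ) : Measurable (powerTail a) := by
  unfold powerTail; fun_prop

lemma lintegral_powerTail_lt_top {a : ℝ} (ha : 1 < a) :
    ∫⁻ x, ENNReal.ofReal (powerTail a x) < ⊤ := by
  have := finite_integral_one_add_norm (E := ℝ) (μ := volume) (r := a) (by simpa using ha)
  simpa [powerTail] using this

/-! ### Changes of variables and product integrals. -/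

lemma lintegral_comp_div_of_pos {σ : ℝ} (hσ : 0 < σ) {f : ℝ → ENNReal} (hf : Measurable f) :
    ∫⁻ u, ENNReal.ofReal σ⁻¹ * f (u / σ) = ∫⁻ u, f u := by
  have h := Real.smul_map_volume_mul_left (a := σ⁻¹) (by positivity)
  conv_rhs => rw [← h]
  rw [lintegral_smul_measure, lintegral_map hf (by fun_prop), lintegral_const_mul _ (by fun_prop),
    abs_of_pos (by positivity)]
  simp [div_eq_inv_mul]

lemma lintegral_comp_sub_div_of_pos {σ : ℝ} (hσ : 0 < σ) (t : ℝ) {f : ℝ → ENNReal}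
    (hf : Measurable f) :
    ∫⁻ u, ENNReal.ofReal σ⁻¹ * f ((u - t) / σ) = ∫⁻ u, f u := by
  rw [lintegral_sub_right_eq_self (fun u => ENNReal.ofReal σ⁻¹ * f (u / σ)) t]
  exact lintegral_comp_div_of_pos hσ hf

lemma lintegral_pi_prod : ∀ {n : ℕ} (f : Fin n → ℝ → ENNReal), (∀ i, Measurable (f i)) →
    ∫⁻ y : Fin n → ℝ, ∏ i, f i (y i) = ∏ i, ∫⁻ u, f i u
  | 0, f, _ => by simp [volume_pi]
  | n + 1, f, hf => by
    have hmp := (volume_preserving_piFinSuccAbove (fun _ : Fin (n + 1) => ℝ) 0).symm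
    rw [← hmp.lintegral_comp (f := fun y => ∏ i, f i (y i)) (Finset.measurable_prod _
      fun i _ => (hf i).comp (measurable_pi_apply i))]
    have : ∀ z : ℝ × (Fin n → ℝ), ∏ i, f i
        ((MeasurableEquiv.piFinSuccAbove (fun _ : Fin (n + 1) => ℝ) 0).symm z i) =
        f 0 z.1 * ∏ i, f i.succ (z.2 i) := fun z => by
      rw [Fin.prod_univ_succ]; rfl
    simp_rw [this]
    have hg : Measurable fun z : Fin n → ℝ => ∏ i : Fin n, f i.succ (z i) :=
      Finset.measurable_prod _ fun i _ => (hf i.succ).comp (measurable_pi_apply i)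
    rw [Fin.prod_univ_succ, ← lintegral_pi_prod (fun i => f i.succ) fun i => hf i.succ]
    exact lintegral_prod_mul (μ := volume) (ν := volume) (hf 0).aemeasurable hg.aemeasurable

/-- Linear change of variables in a Lebesgue integral. -/
lemma lintegral_comp_mulVec {k : ℕ} {A : Matrix (Fin k) (Fin k) ℝ} (hA : A.det ≠ 0)
    {f : (Fin k → ℝ) → ENNReal} (hf : Measurable f) :
    ∫⁻ b, f (A.mulVec b) = ENNReal.ofReal |A.det⁻¹| * ∫⁻ u, f u := by
  have h := Real.map_matrix_volume_pi_eq_smul_volume_pi hA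
  have hm : Measurable (Matrix.toLin' A) :=
    (LinearMap.continuous_of_finiteDimensional _).measurable
  rw [← smul_eq_mul, ← lintegral_smul_measure, ← h, lintegral_map hf hm]
  simp

lemma lintegral_comp_inv_smul {k : ℕ} {σ : ℝ} (hσ : 0 < σ)
    {f : (Fin k → ℝ) → ENNReal} (hf : Measurable f) :
    ∫⁻ b, f (σ⁻¹ • b) = ENNReal.ofReal (σ ^ k) * ∫⁻ u, f u := by
  have h := Measure.map_addHaar_smul (volume : Measure (Fin k → ℝ)) (r := σ⁻¹) (by positivity)
  rw [← lintegral_map hf (by fun_prop : Measurable fun b : Fin k → ℝ => σ⁻¹ • b), h,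
    lintegral_smul_measure]
  simp [abs_of_pos hσ]

/-! ### Linear algebra of row bases. -/

namespace Matrix

variable {n k : ℕ}

/-- Cofactor expansion of the determinant after a row replacement, through a column of the
inverse. -/
lemma det_updateRow_eq_det_mul_dotProduct_inv {A : Matrix (Fin k) (Fin k) ℝ} (hA : A.det ≠ 0)
    (l : Fin k) (v : Fin k → ℝ) :
    (A.updateRow l v).det = A.det * (v ⬝ᵥ fun j => A⁻¹ j l) := by
  rw [← cramer_transpose_apply, Matrix.cramer_eq_adjugate_mulVec, Matrix.inv_def,
    Ring.inverse_eq_inv', ← adjugate_transpose]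
  simp only [mulVec, dotProduct, Matrix.transpose_apply, Matrix.smul_apply, smul_eq_mul,
    Finset.mul_sum]
  refine Finset.sum_congr rfl fun j _ => ?_
  field_simp

lemma exists_submatrix_det_ne_zero {X : Matrix (Fin n) (Fin k) ℝ} (hX : X.rank = k) :
    ∃ e : Fin k → Fin n, (X.submatrix e id).det ≠ 0 := by
  have h : Module.finrank ℝ (Submodule.span ℝ (Set.range X.row)) = k := by
    rw [← Matrix.rank_eq_finrank_span_row, hX]
  obtain ⟨f, hf, -, hli⟩ := Submodule.exists_fun_fin_finrank_span_eq ℝ (Set.range X.row)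
  choose e he using hf
  refine ⟨fun i => e (finCongr h.symm i), ?_⟩
  rw [← isUnit_iff_ne_zero, ← Matrix.isUnit_iff_isUnit_det, ← linearIndependent_rows_iff_isUnit]
  have hrow : (X.submatrix (fun i => e (finCongr h.symm i)) id).row = f ∘ finCongr h.symm := by
    ext i j
    simp [← he]
  rw [hrow]
  exact hli.comp (finCongr h.symm) (finCongr h.symm).injective

/-- Rank of a matrix is unchanged when a column is removed on which some kernel vector does not
vanish. -/
lemma rank_submatrix_remove_col {m : Type*} [Fintype m] (Y : Matrix m (Fin k) ℝ) (j : Fin k)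
    {d : Fin k → ℝ} (hd : d j ≠ 0) (hY : Y.mulVec d = 0) :
    (Y.submatrix id (fun l : {l : Fin k // l ≠ j} => (l : Fin k))).rank = Y.rank := by
  rw [rank_eq_finrank_span_cols, rank_eq_finrank_span_cols]
  suffices h : Submodule.span ℝ (Set.range
      (Y.submatrix id (fun l : {l : Fin k // l ≠ j} => (l : Fin k))).col) =
      Submodule.span ℝ (Set.range Y.col) by rw [h]
  apply le_antisymm
  · refine Submodule.span_mono ?_
    rintro _ ⟨l, rfl⟩
    exact ⟨l, rfl⟩
  · refine Submodule.span_le.2 ?_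
    rintro _ ⟨l, rfl⟩
    by_cases hl : l = j
    · subst hl
      have : Y.col l = ∑ i : {i : Fin k // i ≠ l},
          (-(d i / d l)) •
            (Y.submatrix id (fun i : {i : Fin k // i ≠ l} => (i : Fin k))).col i := by
        ext a
        have h := congrFun hY a
        simp only [mulVec, dotProduct, Pi.zero_apply] at h
        rw [Fintype.sum_eq_add_sum_compl l, Finset.sum_subtype (p := fun i => i ≠ l) _
          (by simp)] at h
        simp only [col_apply, Finset.sum_apply, Pi.smul_apply, submatrix_apply, id, smul_eq_mul]
        rw [← mul_left_inj' hd, eq_neg_of_add_eq_zero_left h, Finset.sum_mul,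
          ← Finset.sum_neg_distrib]
        refine Finset.sum_congr rfl fun i _ => ?_
        field_simp
      rw [this]
      exact Submodule.sum_mem _ fun i _ => Submodule.smul_mem _ _ (Submodule.subset_span ⟨i, rfl⟩)
    · exact Submodule.subset_span ⟨⟨l, hl⟩, rfl⟩

lemma rank_lt_of_mulVec_eq_zero {m : Type*} [Fintype m] (Y : Matrix m (Fin k) ℝ)
    {d : Fin k → ℝ} (hd : d ≠ 0) (hY : Y.mulVec d = 0) : Y.rank < k := by
  have h := Y.mulVecLin.finrank_range_add_finrank_ker
  have hpos : 0 < Module.finrank ℝ (LinearMap.ker Y.mulVecLin) := by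
    rw [Module.finrank_pos_iff_exists_ne_zero]
    exact ⟨⟨d, by simpa using hY⟩, by simpa [Subtype.ext_iff] using hd⟩
  rw [Module.finrank_fin_fun] at h
  unfold Matrix.rank
  omega

end Matrix

/-! ### Counting rows with the singularity index. -/

variable {n k : ℕ}

lemma singularityIndex_le (X : Matrix (Fin n) (Fin k) ℝ) (j : Fin k) :
    singularityIndex X j ≤ n - k :=
  csSup_le' fun _ hp => hp.1

/-- Rows of `X` orthogonal to a dual basis vector with nonzero coordinate `j` are at most
`k - 1 + p_j` in number. -/
lemma card_add_one_le_of_inv_ne_zero {X : Matrix (Fin n) (Fin k) ℝ} {e : Fin k → Fin n}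
    (hA : (X.submatrix e id).det ≠ 0) {j l : Fin k} (hd : (X.submatrix e id)⁻¹ j l ≠ 0)
    {S : Finset (Fin n)} (hS : ∀ i, i ∈ S ↔ X i ⬝ᵥ (fun m => (X.submatrix e id)⁻¹ m l) = 0) :
    S.card + 1 ≤ k + singularityIndex X j := by
  classical
  set A := X.submatrix e id with hAdef
  set d : Fin k → ℝ := fun m => A⁻¹ m l with hddef
  have hk : 0 < k := j.pos
  have hdual : ∀ m, X (e m) ⬝ᵥ d = if m = l then 1 else 0 := fun m => by
    have := congrFun (congrFun (Matrix.mul_nonsing_inv A (isUnit_iff_ne_zero.2 hA)) m) l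
    rw [Matrix.one_apply] at this
    rw [← this]; rfl
  have he : Function.Injective e := by
    intro a b hab
    by_contra hne
    exact hA (Matrix.det_zero_of_row_eq hne (by ext; simp [hAdef, hab]))
  -- The other `k - 1` basis rows are orthogonal to `d`, which bounds the rank of the rows in `S`
  -- below; `d` in their kernel bounds it above.
  have himg : (Finset.univ.erase l).image e ⊆ S := by
    intro i hi
    obtain ⟨m, hm, rfl⟩ := Finset.mem_image.1 hi
    rw [hS, hdual, if_neg (Finset.ne_of_mem_erase hm)]
  have hcard_ge : k - 1 ≤ S.card := by
    have := Finset.card_le_card himg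
    rwa [Finset.card_image_of_injective _ he, Finset.card_erase_of_mem (Finset.mem_univ _),
      Finset.card_univ, Fintype.card_fin] at this
  have hlS : e l ∉ S := by rw [hS, hdual]; simp
  have hcard_lt : S.card < n := by
    have := Finset.card_lt_card (Finset.ssubset_univ_iff.2
      fun h : S = Finset.univ => hlS (h ▸ Finset.mem_univ _))
    simpa using this
  have hker : (X.submatrix (fun i : S => (i : Fin n)) id).mulVec d = 0 := by
    ext i
    exact (hS i).1 i.2
  have hd0 : d ≠ 0 := fun h => hd (congrFun h j)
  have hrank_lt := Matrix.rank_lt_of_mulVec_eq_zero _ hd0 hker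
  have hrank_ge : k - 1 ≤ (X.submatrix (fun i : S => (i : Fin n)) id).rank := by
    have hli : LinearIndependent ℝ A.row := by
      rw [Matrix.linearIndependent_rows_iff_isUnit, Matrix.isUnit_iff_isUnit_det]
      exact isUnit_iff_ne_zero.2 hA
    let g : {m : Fin k // m ≠ l} → S := fun m =>
      ⟨e m, himg (Finset.mem_image_of_mem _ (by simp [m.2]))⟩
    have h1 : ((X.submatrix (fun i : S => (i : Fin n)) id).submatrix g id).rank = k - 1 := by
      rw [LinearIndependent.rank_matrix]
      · simp
      · exact hli.comp _ Subtype.val_injective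
    rw [← h1]
    exact Matrix.rank_submatrix_le _ _ _
  have hrank : (X.submatrix (fun i : S => (i : Fin n)) id).rank = k - 1 := by omega
  -- Since `d j ≠ 0`, column `j` is a combination of the other columns on `S`, and deleting it keeps
  -- the rank.
  have hsing : HasSingularRows X j (S.card - (k - 1)) := by
    refine ⟨S, by omega, hrank, ?_⟩
    rw [← hrank, ← Matrix.rank_submatrix_remove_col _ j hd hker]
    rfl
  have hmem : S.card - (k - 1) ∈ {p : ℕ | p ≤ n - k ∧ HasSingularRows X j p} :=
    ⟨by omega, hsing⟩
  have hle := le_csSup ⟨n - k, fun p hp => hp.1⟩ hmem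
  unfold singularityIndex
  omega

/-! ### Finiteness of the scale-free integral through minimal row bases. -/

lemma powerTail_pow (a x : ℝ) (N : ℕ) : powerTail a x ^ N = powerTail (a * N) x := by
  unfold powerTail
  rw [← Real.rpow_natCast, ← Real.rpow_mul (by positivity)]; ring_nf

/-- The index sets of the square row submatrices with nonzero determinant. -/
noncomputable def rowBases (X : Matrix (Fin n) (Fin k) ℝ) : Finset (Fin k → Fin n) := by
  classical exact Finset.univ.filter fun e => (X.submatrix e id).det ≠ 0

lemma mem_rowBases {X : Matrix (Fin n) (Fin k) ℝ} {e : Fin k → Fin n} :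
    e ∈ rowBases X ↔ (X.submatrix e id).det ≠ 0 := by
  simp [rowBases]

lemma rowBases_nonempty {X : Matrix (Fin n) (Fin k) ℝ} (hX : X.rank = k) :
    (rowBases X).Nonempty :=
  let ⟨e, he⟩ := Matrix.exists_submatrix_det_ne_zero hX
  ⟨e, mem_rowBases.2 he⟩

/-- The exchange property of a basis of rows which minimises the sum of the absolute values of a
linear functional. -/
lemma abs_mulVec_le_of_minimal {X : Matrix (Fin n) (Fin k) ℝ} {b : Fin k → ℝ} {e : Fin k → Fin n}
    (he : e ∈ rowBases X)
    (hmin : ∀ e' ∈ rowBases X, ∑ m, |X.mulVec b (e m)| ≤ ∑ m, |X.mulVec b (e' m)|)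
    {l : Fin k} {i : Fin n} (hi : X i ⬝ᵥ (fun m => (X.submatrix e id)⁻¹ m l) ≠ 0) :
    |X.mulVec b (e l)| ≤ |X.mulVec b i| := by
  classical
  have hdet := mem_rowBases.1 he
  have hmem : Function.update e l i ∈ rowBases X := by
    rw [mem_rowBases]
    have : X.submatrix (Function.update e l i) id = (X.submatrix e id).updateRow l (X i) := by
      ext m c
      by_cases h : m = l
      · subst h; simp
      · simp [h]
    -- Exchanging row `l` for row `i` multiplies the determinant by `X i ⬝ᵥ d ≠ 0`, so the exchanged
    -- rows are again a basis and compete in the minimum.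
    rw [this, Matrix.det_updateRow_eq_det_mul_dotProduct_inv hdet]
    exact mul_ne_zero hdet hi
  have h := hmin _ hmem
  rw [Fintype.sum_eq_add_sum_compl l, Fintype.sum_eq_add_sum_compl l] at h
  have hrest : ∑ m ∈ {l}ᶜ, |X.mulVec b (Function.update e l i m)| =
      ∑ m ∈ {l}ᶜ, |X.mulVec b (e m)| := by
    refine Finset.sum_congr rfl fun m hm => ?_
    rw [Function.update_of_ne (by simpa using hm)]
  rw [hrest, Function.update_self] at h
  linarith

/-- A vector coordinate is controlled by one dual coordinate on which it depends. -/
lemma exists_inv_ne_zero_abs_le {A : Matrix (Fin k) (Fin k) ℝ} (hA : A.det ≠ 0) (b : Fin k → ℝ)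
    (j : Fin k) : ∃ l, A⁻¹ j l ≠ 0 ∧ |b j| ≤ (∑ m, |A⁻¹ j m|) * |A.mulVec b l| := by
  classical
  have hne : (Finset.univ.filter fun l => A⁻¹ j l ≠ 0).Nonempty := by
    by_contra h
    have hz : ∀ l, A⁻¹ j l = 0 := fun l => by
      by_contra hl
      exact h ⟨l, by simpa using hl⟩
    have := congrFun (congrFun (Matrix.nonsing_inv_mul A (isUnit_iff_ne_zero.2 hA)) j) j
    rw [Matrix.mul_apply] at this
    simp [hz] at this
  obtain ⟨l, hl, hmax⟩ := Finset.exists_max_image _ (fun l => |A.mulVec b l|) hne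
  refine ⟨l, (Finset.mem_filter.1 hl).2, ?_⟩
  have hb : b j = ∑ m, A⁻¹ j m * A.mulVec b m := by
    have : A⁻¹.mulVec (A.mulVec b) = b := by
      rw [Matrix.mulVec_mulVec, Matrix.nonsing_inv_mul A (isUnit_iff_ne_zero.2 hA),
        Matrix.one_mulVec]
    conv_lhs => rw [← this]
    rfl
  rw [hb, Finset.sum_mul]
  refine (Finset.abs_sum_le_sum_abs _ _).trans (Finset.sum_le_sum fun m _ => ?_)
  rw [abs_mul]
  by_cases hm : A⁻¹ j m = 0
  · simp [hm]
  · exact mul_le_mul_of_nonneg_left (hmax m (by simpa using hm)) (abs_nonneg _)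

/-- Pointwise domination of a moment weight by finitely many product functions of independent
linear coordinates. -/
lemma exists_moment_mul_prod_powerTail_le {X : Matrix (Fin n) (Fin k) ℝ} (hX : X.rank = k)
    (j : Fin k) {a r : ℝ} (ha : 0 ≤ a) (hr : 0 ≤ r) :
    ∃ C : ℝ, 0 ≤ C ∧ ∀ b : Fin k → ℝ, |b j| ^ r * ∏ i, powerTail a (X.mulVec b i) ≤
      C * ∑ e ∈ rowBases X, ∑ l, ∏ m,
        powerTail (if m = l then a * (n - k + 1 - singularityIndex X j) - r else a)
          ((X.submatrix e id).mulVec b m) := by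
  classical
  -- The minimising basis depends on `b`, so the constant and the bound both sum over all bases.
  refine ⟨∑ e ∈ rowBases X, (∑ m, |(X.submatrix e id)⁻¹ j m|) ^ r,
    Finset.sum_nonneg fun e _ => by positivity, fun b => ?_⟩
  obtain ⟨e, he, hmin⟩ := Finset.exists_min_image _ (fun e => ∑ m, |X.mulVec b (e m)|)
    (rowBases_nonempty hX)
  have hdet := mem_rowBases.1 he
  obtain ⟨l, hl, hb⟩ := exists_inv_ne_zero_abs_le hdet b j
  set A := X.submatrix e id with hAdef
  set c := ∑ m, |A⁻¹ j m| with hc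
  have hc0 : 0 ≤ c := Finset.sum_nonneg fun _ _ => abs_nonneg _
  set S : Finset (Fin n) := Finset.univ.filter
    fun i => X i ⬝ᵥ (fun m => A⁻¹ m l) = 0 with hSdef
  have hS : ∀ i, i ∈ S ↔ X i ⬝ᵥ (fun m => A⁻¹ m l) = 0 := fun i => by simp [hSdef]
  have hcard := card_add_one_le_of_inv_ne_zero hdet hl hS
  have hinj : Function.Injective e := by
    intro x y hxy
    by_contra hne
    exact hdet (Matrix.det_zero_of_row_eq hne (by ext; simp [hAdef, hxy]))
  have hsub : (Finset.univ.erase l).image e ⊆ S := by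
    intro i hi
    obtain ⟨m, hm, rfl⟩ := Finset.mem_image.1 hi
    have := congrFun (congrFun (Matrix.mul_nonsing_inv A (isUnit_iff_ne_zero.2 hdet)) m) l
    rw [Matrix.one_apply, if_neg (Finset.ne_of_mem_erase hm)] at this
    rw [hS, ← this]; rfl
  have h1 : ∏ i ∈ S, powerTail a (X.mulVec b i) ≤
      ∏ m ∈ Finset.univ.erase l, powerTail a (A.mulVec b m) := by
    rw [← Finset.prod_sdiff hsub, Finset.prod_image fun _ _ _ _ h => hinj h]
    exact mul_le_of_le_one_left (Finset.prod_nonneg fun _ _ => powerTail_nonneg _ _)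
      (Finset.prod_le_one (fun _ _ => powerTail_nonneg _ _) fun _ _ => powerTail_le_one ha _)
  have h2 : ∏ i ∈ Sᶜ, powerTail a (X.mulVec b i) ≤
      powerTail (a * (n - k + 1 - singularityIndex X j)) (A.mulVec b l) := by
    calc ∏ i ∈ Sᶜ, powerTail a (X.mulVec b i) ≤ ∏ i ∈ Sᶜ, powerTail a (A.mulVec b l) := by
          refine Finset.prod_le_prod (fun _ _ => powerTail_nonneg _ _) fun i hi => ?_
          refine powerTail_anti_abs ha (abs_mulVec_le_of_minimal he hmin ?_)
          rw [Finset.mem_compl, hS] at hi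
          exact hi
      _ = powerTail (a * (Sᶜ.card : ℕ)) (A.mulVec b l) := by
          rw [Finset.prod_const, powerTail_pow]
      _ ≤ _ := by
          refine powerTail_anti_exponent (mul_le_mul_of_nonneg_left ?_ ha) _
          have : (Sᶜ.card : ℝ) = n - S.card := by
            rw [eq_sub_iff_add_eq, ← Nat.cast_add, add_comm, Finset.card_add_card_compl,
              Fintype.card_fin]
          rw [this]
          have : (S.card : ℝ) + 1 ≤ k + singularityIndex X j := by exact_mod_cast hcard
          linarith
  have h3 : |b j| ^ r ≤ c ^ r * powerTail (-r) (A.mulVec b l) := by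
    rw [powerTail_neg, ← Real.mul_rpow hc0 (by positivity)]
    refine Real.rpow_le_rpow (abs_nonneg _) (hb.trans ?_) hr
    exact mul_le_mul_of_nonneg_left (by linarith) hc0
  have hterm : ∀ e' ∈ rowBases X, 0 ≤ ∑ l, ∏ m,
        powerTail (if m = l then a * (n - k + 1 - singularityIndex X j) - r else a)
          ((X.submatrix e' id).mulVec b m) := fun e' _ =>
    Finset.sum_nonneg fun _ _ => Finset.prod_nonneg fun _ _ => powerTail_nonneg _ _
  have hprod : ∏ m, powerTail (if m = l then a * (n - k + 1 - singularityIndex X j) - r else a)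
      (A.mulVec b m) = powerTail (a * (n - k + 1 - singularityIndex X j) - r) (A.mulVec b l) *
      ∏ m ∈ Finset.univ.erase l, powerTail a (A.mulVec b m) := by
    rw [← Finset.mul_prod_erase _ _ (Finset.mem_univ l), if_pos rfl]
    congr 1
    exact Finset.prod_congr rfl fun m hm => by rw [if_neg (Finset.ne_of_mem_erase hm)]
  calc |b j| ^ r * ∏ i, powerTail a (X.mulVec b i)
      = |b j| ^ r * ((∏ i ∈ S, powerTail a (X.mulVec b i)) *
          ∏ i ∈ Sᶜ, powerTail a (X.mulVec b i)) := by rw [Finset.prod_mul_prod_compl]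
    _ ≤ (c ^ r * powerTail (-r) (A.mulVec b l)) *
          ((∏ m ∈ Finset.univ.erase l, powerTail a (A.mulVec b m)) *
          powerTail (a * (n - k + 1 - singularityIndex X j)) (A.mulVec b l)) := by
        have hp : ∀ s : Finset (Fin n), 0 ≤ ∏ i ∈ s, powerTail a (X.mulVec b i) := fun s =>
          Finset.prod_nonneg fun _ _ => powerTail_nonneg _ _
        refine mul_le_mul h3 (mul_le_mul h1 h2 (hp _) ?_) (mul_nonneg (hp _) (hp _)) ?_
        · exact Finset.prod_nonneg fun _ _ => powerTail_nonneg _ _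
        · exact mul_nonneg (by positivity) (powerTail_nonneg _ _)
    _ = c ^ r * ∏ m, powerTail (if m = l then a * (n - k + 1 - singularityIndex X j) - r else a)
          (A.mulVec b m) := by
        rw [hprod, sub_eq_add_neg (a * _) r, ← powerTail_mul_powerTail]; ring
    _ ≤ _ := by
        refine mul_le_mul ?_ ?_ (Finset.prod_nonneg fun _ _ => powerTail_nonneg _ _)
          (Finset.sum_nonneg fun _ _ => by positivity)
        · exact Finset.single_le_sum (f := fun e => (∑ m, |(X.submatrix e id)⁻¹ j m|) ^ r)
            (fun _ _ => by positivity) he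
        · refine le_trans ?_ (Finset.single_le_sum hterm he)
          exact Finset.single_le_sum (f := fun l => ∏ m,
            powerTail (if m = l then a * (n - k + 1 - singularityIndex X j) - r else a)
              ((X.submatrix e id).mulVec b m))
            (fun _ _ => Finset.prod_nonneg fun _ _ => powerTail_nonneg _ _) (Finset.mem_univ l)

lemma lintegral_prod_powerTail_mulVec_lt_top {A : Matrix (Fin k) (Fin k) ℝ} (hA : A.det ≠ 0)
    {α : Fin k → ℝ} (hα : ∀ m, 1 < α m) :
    ∫⁻ b, ENNReal.ofReal (∏ m, powerTail (α m) (A.mulVec b m)) < ⊤ := by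
  have hf : ∀ m, Measurable fun x => ENNReal.ofReal (powerTail (α m) x) := fun m => by fun_prop
  have hm : Measurable fun u : Fin k → ℝ => ∏ m, ENNReal.ofReal (powerTail (α m) (u m)) := by
    fun_prop
  have h := lintegral_comp_mulVec hA hm
  simp_rw [ENNReal.ofReal_prod_of_nonneg fun m _ => powerTail_nonneg (α m) (A.mulVec _ m)]
  rw [h, lintegral_pi_prod _ hf]
  exact ENNReal.mul_lt_top ENNReal.ofReal_lt_top
    (ENNReal.prod_lt_top fun m _ => lintegral_powerTail_lt_top (hα m))

/-- Factors outside one row basis are at most 1 and can be dropped. No column is named, so the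
normalising constant is covered even for `k = 0`. -/
lemma lintegral_prod_powerTail_lt_top {X : Matrix (Fin n) (Fin k) ℝ} (hX : X.rank = k) {a : ℝ}
    (ha : 1 < a) : ∫⁻ b, ENNReal.ofReal (∏ i, powerTail a (X.mulVec b i)) < ⊤ := by
  classical
  obtain ⟨e, he⟩ := Matrix.exists_submatrix_det_ne_zero hX
  have hinj : Function.Injective e := by
    intro x y hxy
    by_contra hne
    exact he (Matrix.det_zero_of_row_eq hne (by ext; simp [hxy]))
  refine lt_of_le_of_lt (lintegral_mono fun b => ENNReal.ofReal_le_ofReal ?_)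
    (lintegral_prod_powerTail_mulVec_lt_top he (α := fun _ => a) fun _ => ha)
  rw [← Finset.prod_sdiff (Finset.subset_univ (Finset.univ.image e)),
    Finset.prod_image fun _ _ _ _ h => hinj h]
  exact mul_le_of_le_one_left (Finset.prod_nonneg fun _ _ => powerTail_nonneg _ _)
    (Finset.prod_le_one (fun _ _ => powerTail_nonneg _ _)
      fun _ _ => powerTail_le_one (by linarith) _)

lemma measurable_mulVec {m : ℕ} (A : Matrix (Fin m) (Fin k) ℝ) (i : Fin m) :
    Measurable fun b : Fin k → ℝ => A.mulVec b i := by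
  unfold Matrix.mulVec dotProduct; fun_prop

lemma lintegral_moment_mul_prod_powerTail_lt_top {X : Matrix (Fin n) (Fin k) ℝ}
    (hX : X.rank = k) (j : Fin k) {a r : ℝ} (ha : 1 < a) (hr : 0 ≤ r)
    (h : r + 1 < a * (n - k + 1 - singularityIndex X j)) :
    ∫⁻ b, ENNReal.ofReal (|b j| ^ r * ∏ i, powerTail a (X.mulVec b i)) < ⊤ := by
  obtain ⟨C, hC, hle⟩ := exists_moment_mul_prod_powerTail_le hX j (by linarith : 0 ≤ a) hr
  refine lt_of_le_of_lt (lintegral_mono fun b => ENNReal.ofReal_le_ofReal (hle b)) ?_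
  have hnn : ∀ (e : Fin k → Fin n) (l : Fin k) (b : Fin k → ℝ), 0 ≤ ∏ m,
      powerTail (if m = l then a * (n - k + 1 - singularityIndex X j) - r else a)
        ((X.submatrix e id).mulVec b m) := fun e l b =>
    Finset.prod_nonneg fun _ _ => powerTail_nonneg _ _
  have hmeas : ∀ (e : Fin k → Fin n) (l : Fin k), Measurable fun b : Fin k → ℝ => ENNReal.ofReal (∏ m,
      powerTail (if m = l then a * (n - k + 1 - singularityIndex X j) - r else a)
        ((X.submatrix e id).mulVec b m)) := fun e l =>
    (Finset.measurable_prod _ fun m _ =>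
      (measurable_powerTail _).comp (measurable_mulVec _ m)).ennreal_ofReal
  have hsplit : ∀ b : Fin k → ℝ, ENNReal.ofReal (C * ∑ e ∈ rowBases X, ∑ l, ∏ m,
      powerTail (if m = l then a * (n - k + 1 - singularityIndex X j) - r else a)
        ((X.submatrix e id).mulVec b m)) =
      ENNReal.ofReal C * ∑ e ∈ rowBases X, ∑ l, ENNReal.ofReal (∏ m,
        powerTail (if m = l then a * (n - k + 1 - singularityIndex X j) - r else a)
          ((X.submatrix e id).mulVec b m)) := fun b => by
    rw [ENNReal.ofReal_mul hC, ENNReal.ofReal_sum_of_nonneg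
      fun e _ => Finset.sum_nonneg fun l _ => hnn e l b]
    congr 1
    exact Finset.sum_congr rfl fun e _ => ENNReal.ofReal_sum_of_nonneg fun l _ => hnn e l b
  simp_rw [hsplit]
  rw [lintegral_const_mul _ (Finset.measurable_sum _ fun e _ =>
    Finset.measurable_sum _ fun l _ => hmeas e l),
    lintegral_finsetSum _ (fun e _ => Finset.measurable_sum _ fun l _ => hmeas e l)]
  refine ENNReal.mul_lt_top ENNReal.ofReal_lt_top (ENNReal.sum_lt_top.2 fun e he => ?_)
  rw [lintegral_finsetSum _ fun l _ => hmeas e l]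
  refine ENNReal.sum_lt_top.2 fun l _ => ?_
  refine lintegral_prod_powerTail_mulVec_lt_top (mem_rowBases.1 he) fun m => ?_
  split_ifs
  · linarith
  · exact ha

/-! ### The power-tail model at large scales. -/

/-- The likelihood of the linear model whose errors have the (unnormalised) density
`(1 + |ε|) ^ (-a)`. -/
noncomputable def powerTailLikelihood (a : ℝ) (X : Matrix (Fin n) (Fin k) ℝ) (y : Fin n → ℝ)
    (σ : ℝ) (β : Fin k → ℝ) : ℝ :=
  ∏ i, (σ⁻¹ * powerTail a ((y i - X.mulVec β i) / σ))

lemma powerTailLikelihood_nonneg (a : ℝ) (X : Matrix (Fin n) (Fin k) ℝ) (y : Fin n → ℝ)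
    {σ : ℝ} (hσ : 0 < σ) (β : Fin k → ℝ) : 0 ≤ powerTailLikelihood a X y σ β :=
  Finset.prod_nonneg fun _ _ => mul_nonneg (by positivity) (powerTail_nonneg _ _)

@[fun_prop]
lemma Measurable.mulVec_apply {α : Type*} [MeasurableSpace α] (X : Matrix (Fin n) (Fin k) ℝ)
    (i : Fin n) {f : α → Fin k → ℝ} (hf : Measurable f) :
    Measurable fun x => X.mulVec (f x) i :=
  (measurable_mulVec X i).comp hf

lemma measurable_powerTailLikelihood (a : ℝ) (X : Matrix (Fin n) (Fin k) ℝ) :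
    Measurable fun p : (Fin n → ℝ) × ℝ × (Fin k → ℝ) =>
      powerTailLikelihood a X p.1 p.2.1 p.2.2 := by
  unfold powerTailLikelihood
  refine Finset.measurable_prod _ fun i _ => ?_
  exact Measurable.mul (by fun_prop) ((measurable_powerTail a).comp (by fun_prop))

/-- The integral of a power-tail likelihood and a weight against `dβ dσ / σ` over `σ ∈ s`. -/
noncomputable def powerTailIntegral (a : ℝ) (X : Matrix (Fin n) (Fin k) ℝ)
    (W : (Fin k → ℝ) → ℝ) (s : Set ℝ) (y : Fin n → ℝ) : ENNReal :=
  ∫⁻ σ in s, ENNReal.ofReal σ⁻¹ *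
    ∫⁻ β, ENNReal.ofReal (W β * powerTailLikelihood a X y σ β)

/-- Finiteness over large scales, for every observation. -/
lemma powerTailIntegral_Ioi_one_lt_top {X : Matrix (Fin n) (Fin k) ℝ} {W : (Fin k → ℝ) → ℝ}
    (hW0 : ∀ b, 0 ≤ W b) (hWm : Measurable W) {a r : ℝ} (ha : 0 ≤ a)
    (hWr : ∀ σ : ℝ, 0 < σ → ∀ b, W (σ • b) = σ ^ r * W b)
    (hK : ∫⁻ b, ENNReal.ofReal (W b * ∏ i, powerTail a (X.mulVec b i)) < ⊤)
    (hr : r < n - k) (y : Fin n → ℝ) :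
    powerTailIntegral a X W (Ioi 1) y < ⊤ := by
  set K := ∫⁻ b, ENNReal.ofReal (W b * ∏ i, powerTail a (X.mulVec b i)) with hKdef
  set D : ℝ := ∏ i, (powerTail a (y i))⁻¹ with hD
  have hD0 : 0 ≤ D := Finset.prod_nonneg fun _ _ => inv_nonneg.2 (powerTail_nonneg _ _)
  -- For `σ > 1` the shift `u / σ` is no larger than `u`, so removing the observation costs a
  -- constant independent of `σ`.
  have hfac : ∀ σ : ℝ, 1 < σ → ∀ t u : ℝ,
      powerTail a ((u - t) / σ) ≤ (powerTail a u)⁻¹ * powerTail a (σ⁻¹ * t) := by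
    intro σ hσ t u
    have hσ0 : 0 < σ := by linarith
    have h1 := powerTail_mul_powerTail_le ha ((u - t) / σ) (-(u / σ))
    have h2 : powerTail a u ≤ powerTail a (-(u / σ)) := by
      refine powerTail_anti_abs ha ?_
      rw [abs_neg, abs_div, abs_of_pos hσ0]
      exact div_le_self (abs_nonneg _) hσ.le
    have h3 : powerTail a ((u - t) / σ + -(u / σ)) = powerTail a (σ⁻¹ * t) := by
      unfold powerTail
      rw [← abs_neg]; congr 3; field_simp; ring
    rw [h3] at h1
    rw [le_inv_mul_iff₀ (powerTail_pos _ _), mul_comm]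
    exact (mul_le_mul_of_nonneg_left h2 (powerTail_nonneg _ _)).trans h1
  have hmeas : Measurable fun b : Fin k → ℝ =>
      ENNReal.ofReal (W b * ∏ i, powerTail a (X.mulVec b i)) :=
    (hWm.mul (Finset.measurable_prod _ fun i _ =>
      (measurable_powerTail a).comp (measurable_mulVec X i))).ennreal_ofReal
  have hinner : ∀ σ : ℝ, 1 < σ → ENNReal.ofReal σ⁻¹ *
      ∫⁻ β, ENNReal.ofReal (W β * powerTailLikelihood a X y σ β) ≤
      ENNReal.ofReal (σ ^ (r - n + k - 1)) * (ENNReal.ofReal D * K) := by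
    intro σ hσ
    have hσ0 : 0 < σ := by linarith
    have hle : ∀ β, ENNReal.ofReal (W β * powerTailLikelihood a X y σ β) ≤
        ENNReal.ofReal (D * σ ^ (r - n)) *
          ENNReal.ofReal (W (σ⁻¹ • β) * ∏ i, powerTail a (X.mulVec (σ⁻¹ • β) i)) := by
      intro β
      rw [← ENNReal.ofReal_mul (mul_nonneg hD0 (by positivity))]
      refine ENNReal.ofReal_le_ofReal ?_
      have hWβ : W β = σ ^ r * W (σ⁻¹ • β) := by
        rw [← hWr σ hσ0, smul_smul, mul_inv_cancel₀ hσ0.ne', one_smul]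
      have hprod : powerTailLikelihood a X y σ β ≤
          (σ ^ n)⁻¹ * (D * ∏ i, powerTail a (X.mulVec (σ⁻¹ • β) i)) := by
        unfold powerTailLikelihood
        rw [Finset.prod_mul_distrib, Finset.prod_const, Finset.card_univ, Fintype.card_fin,
          inv_pow, hD, ← Finset.prod_mul_distrib]
        refine mul_le_mul_of_nonneg_left (Finset.prod_le_prod
          (fun _ _ => powerTail_nonneg _ _) fun i _ => ?_) (by positivity)
        rw [Matrix.mulVec_smul]
        exact hfac σ hσ _ _
      rw [hWβ, Real.rpow_sub hσ0, Real.rpow_natCast]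
      calc σ ^ r * W (σ⁻¹ • β) * powerTailLikelihood a X y σ β
          ≤ σ ^ r * W (σ⁻¹ • β) *
            ((σ ^ n)⁻¹ * (D * ∏ i, powerTail a (X.mulVec (σ⁻¹ • β) i))) :=
            mul_le_mul_of_nonneg_left hprod (mul_nonneg (by positivity) (hW0 _))
        _ = _ := by ring
    calc _ ≤ ENNReal.ofReal σ⁻¹ * ∫⁻ β, ENNReal.ofReal (D * σ ^ (r - n)) *
          ENNReal.ofReal (W (σ⁻¹ • β) * ∏ i, powerTail a (X.mulVec (σ⁻¹ • β) i)) := by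
          gcongr with β; exact hle β
      _ = ENNReal.ofReal σ⁻¹ * (ENNReal.ofReal (D * σ ^ (r - n)) *
          (ENNReal.ofReal (σ ^ k) * K)) := by
          rw [lintegral_const_mul' _ _ ENNReal.ofReal_ne_top,
            lintegral_comp_inv_smul hσ0 hmeas]
      _ = _ := by
          rw [ENNReal.ofReal_mul hD0]
          have : σ ^ (r - n + k - 1) = σ⁻¹ * σ ^ (r - n) * σ ^ k := by
            rw [Real.rpow_sub hσ0, Real.rpow_add hσ0, Real.rpow_natCast, Real.rpow_one]
            field_simp
          rw [this, ENNReal.ofReal_mul (by positivity), ENNReal.ofReal_mul (by positivity)]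
          ring
  refine lt_of_le_of_lt (setLIntegral_mono (by fun_prop) fun σ hσ => hinner σ hσ) ?_
  rw [lintegral_mul_const _ (by fun_prop)]
  refine ENNReal.mul_lt_top ?_ (ENNReal.mul_lt_top ENNReal.ofReal_lt_top hK)
  have hint : IntegrableOn (fun σ : ℝ => σ ^ (r - n + k - 1)) (Ioi 1) :=
    integrableOn_Ioi_rpow_of_lt (by linarith) one_pos
  exact hint.lintegral_lt_top

/-! ### The power-tail model at small scales. -/

/-- Extracts decay at unit scale from a concentrated kernel. For `|δ| ≤ 1` the factor `2 ^ a *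
powerTail a δ` is at least 1; for `|δ| ≥ 1` the kernel is at most that factor times `σ ^ (a - 1) ≤
1`. -/
lemma inv_mul_powerTail_div_le {a σ : ℝ} (ha : 1 ≤ a) (hσ : 0 < σ) (hσ1 : σ ≤ 1) (δ : ℝ) :
    σ⁻¹ * powerTail a (δ / σ) ≤ 2 ^ a * powerTail a δ * (σ⁻¹ * powerTail a (δ / σ) + 1) := by
  have hp : 0 ≤ σ⁻¹ * powerTail a (δ / σ) := mul_nonneg (by positivity) (powerTail_nonneg _ _)
  have hq : 0 ≤ 2 ^ a * powerTail a δ := mul_nonneg (by positivity) (powerTail_nonneg _ _)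
  rcases le_total |δ| 1 with h | h
  · have h1 : 1 ≤ 2 ^ a * powerTail a δ := by
      unfold powerTail
      rw [Real.rpow_neg (by positivity), ← div_eq_mul_inv, one_le_div (by positivity)]
      exact Real.rpow_le_rpow (by positivity) (by linarith) (by linarith)
    nlinarith
  · have h1 : σ⁻¹ * powerTail a (δ / σ) ≤ 2 ^ a * powerTail a δ := by
      have h2 : powerTail a (δ / σ) ≤ ((1 + |δ|) / (2 * σ)) ^ (-a) := by
        refine Real.rpow_le_rpow_of_nonpos (by positivity) ?_ (by linarith)
        rw [abs_div, abs_of_pos hσ, div_le_iff₀ (by positivity)]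
        field_simp
        nlinarith
      have h3 : ((1 + |δ|) / (2 * σ)) ^ (-a) = 2 ^ a * σ ^ a * powerTail a δ := by
        unfold powerTail
        rw [Real.div_rpow (by positivity) (by positivity), Real.rpow_neg (by positivity) a,
          Real.rpow_neg (by positivity) a, Real.mul_rpow (by positivity) hσ.le]
        field_simp
      have h4 : σ⁻¹ * σ ^ a ≤ 1 := by
        rw [← Real.rpow_neg_one, ← Real.rpow_add hσ]
        exact Real.rpow_le_one hσ.le hσ1 (by linarith)
      calc σ⁻¹ * powerTail a (δ / σ) ≤ σ⁻¹ * (2 ^ a * σ ^ a * powerTail a δ) := by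
            rw [← h3]; exact mul_le_mul_of_nonneg_left h2 (by positivity)
        _ = (σ⁻¹ * σ ^ a) * (2 ^ a * powerTail a δ) := by ring
        _ ≤ _ := mul_le_of_le_one_left hq h4
    nlinarith

/-- Of the exponent `a + 2`, the part `a` converts decay in `u - t` into decay in `t`, and the part
2 keeps the remaining term integrable in `u`. -/
lemma powerTail_mul_scaled_powerTail_le {a σ : ℝ} (ha : 1 ≤ a) (hσ : 0 < σ) (hσ1 : σ ≤ 1)
    (t u : ℝ) :
    powerTail (a + 2) u * (σ⁻¹ * powerTail a ((u - t) / σ)) ≤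
      2 ^ a * powerTail a t * (σ⁻¹ * powerTail a ((u - t) / σ) + powerTail 2 u) := by
  have h1 := inv_mul_powerTail_div_le ha hσ hσ1 (u - t)
  have h2 := powerTail_mul_powerTail_le (by linarith : 0 ≤ a) u (-(u - t))
  have h3 : powerTail a (-(u - t)) = powerTail a (u - t) := by simp only [powerTail, abs_neg]
  rw [h3, show u + -(u - t) = t by ring] at h2
  have hu2 := powerTail_nonneg 2 u
  have hu2' := powerTail_le_one (by norm_num : (0 : ℝ) ≤ 2) u
  have hp : 0 ≤ σ⁻¹ * powerTail a ((u - t) / σ) :=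
    mul_nonneg (by positivity) (powerTail_nonneg _ _)
  have ht : 0 ≤ 2 ^ a * powerTail a t := mul_nonneg (by positivity) (powerTail_nonneg _ _)
  set p := σ⁻¹ * powerTail a ((u - t) / σ)
  rw [← powerTail_mul_powerTail]
  calc powerTail a u * powerTail 2 u * p
      ≤ powerTail a u * powerTail 2 u * (2 ^ a * powerTail a (u - t) * (p + 1)) :=
        mul_le_mul_of_nonneg_left h1 (mul_nonneg (powerTail_nonneg _ _) hu2)
    _ = 2 ^ a * (powerTail a u * powerTail a (u - t)) * (powerTail 2 u * (p + 1)) := by ring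
    _ ≤ 2 ^ a * powerTail a t * (powerTail 2 u * (p + 1)) :=
        mul_le_mul_of_nonneg_right (mul_le_mul_of_nonneg_left h2 (by positivity)) (by positivity)
    _ ≤ _ := mul_le_mul_of_nonneg_left (by nlinarith) ht

lemma lintegral_powerTail_mul_scaled_powerTail_le {a σ : ℝ} (ha : 1 ≤ a) (hσ : 0 < σ)
    (hσ1 : σ ≤ 1) (t : ℝ) :
    ∫⁻ u, ENNReal.ofReal (powerTail (a + 2) u * (σ⁻¹ * powerTail a ((u - t) / σ))) ≤
      ENNReal.ofReal (2 ^ a) * ((∫⁻ u, ENNReal.ofReal (powerTail a u)) +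
        ∫⁻ u, ENNReal.ofReal (powerTail 2 u)) * ENNReal.ofReal (powerTail a t) := by
  have hm : Measurable fun u => ENNReal.ofReal σ⁻¹ * ENNReal.ofReal (powerTail a ((u - t) / σ)) :=
    ((measurable_powerTail a).comp (by fun_prop)).ennreal_ofReal.const_mul _
  calc _ ≤ ∫⁻ u, ENNReal.ofReal (2 ^ a * powerTail a t) *
        (ENNReal.ofReal σ⁻¹ * ENNReal.ofReal (powerTail a ((u - t) / σ)) +
          ENNReal.ofReal (powerTail 2 u)) := by
        refine lintegral_mono fun u => ?_
        refine (ENNReal.ofReal_le_ofReal (powerTail_mul_scaled_powerTail_le ha hσ hσ1 t u)).trans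
          (le_of_eq ?_)
        rw [ENNReal.ofReal_mul (mul_nonneg (by positivity) (powerTail_nonneg _ _)),
          ENNReal.ofReal_add (mul_nonneg (by positivity) (powerTail_nonneg _ _))
            (powerTail_nonneg _ _), ENNReal.ofReal_mul (p := σ⁻¹) (by positivity)]
    _ = _ := by
        rw [lintegral_const_mul' _ _ ENNReal.ofReal_ne_top, lintegral_add_left hm,
          lintegral_comp_sub_div_of_pos hσ t
            (f := fun v => ENNReal.ofReal (powerTail a v)) (by fun_prop),
          ENNReal.ofReal_mul (by positivity)]
        ring

/-- A power of the distance to the column space is absorbed by one tail factor. -/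
lemma infDist_rpow_mul_powerTailLikelihood_le (hn : 0 < n) (X : Matrix (Fin n) (Fin k) ℝ)
    (y : Fin n → ℝ) (β : Fin k → ℝ) {a s σ : ℝ} (hs : 0 ≤ s) (hσ : 0 < σ) :
    Metric.infDist y (range X.mulVec) ^ s * powerTailLikelihood (a + s) X y σ β ≤
      σ ^ s * powerTailLikelihood a X y σ β := by
  classical
  have : Nonempty (Fin n) := ⟨⟨0, hn⟩⟩
  -- The distance on `Fin n → ℝ` is the sup distance, so the largest residual alone dominates
  -- `infDist`.
  obtain ⟨i, hi⟩ := Finite.exists_max fun i => |y i - X.mulVec β i|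
  have hdist : Metric.infDist y (range X.mulVec) ≤ |y i - X.mulVec β i| :=
    (Metric.infDist_le_dist_of_mem (mem_range_self β)).trans
      ((dist_pi_le_iff (abs_nonneg _)).2 fun m => by rw [Real.dist_eq]; exact hi m)
  set δ := y i - X.mulVec β i with hδ
  have hone : Metric.infDist y (range X.mulVec) ^ s * powerTail (a + s) (δ / σ) ≤
      σ ^ s * powerTail a (δ / σ) := by
    have h1 : Metric.infDist y (range X.mulVec) ^ s ≤ σ ^ s * powerTail (-s) (δ / σ) := by
      rw [powerTail_neg, ← Real.mul_rpow hσ.le (by positivity)]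
      refine Real.rpow_le_rpow Metric.infDist_nonneg (hdist.trans ?_) hs
      rw [abs_div, abs_of_pos hσ, mul_add, mul_div_cancel₀ _ hσ.ne']
      linarith
    calc _ ≤ σ ^ s * powerTail (-s) (δ / σ) * powerTail (a + s) (δ / σ) :=
          mul_le_mul_of_nonneg_right h1 (powerTail_nonneg _ _)
      _ = _ := by rw [mul_assoc, powerTail_mul_powerTail]; congr 2; ring
  have hnn : ∀ m, 0 ≤ σ⁻¹ * powerTail a ((y m - X.mulVec β m) / σ) := fun m =>
    mul_nonneg (by positivity) (powerTail_nonneg _ _)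
  have hnn' : ∀ m, 0 ≤ σ⁻¹ * powerTail (a + s) ((y m - X.mulVec β m) / σ) := fun m =>
    mul_nonneg (by positivity) (powerTail_nonneg _ _)
  have hrest : ∏ m ∈ Finset.univ.erase i, σ⁻¹ * powerTail (a + s) ((y m - X.mulVec β m) / σ) ≤
      ∏ m ∈ Finset.univ.erase i, σ⁻¹ * powerTail a ((y m - X.mulVec β m) / σ) :=
    Finset.prod_le_prod (fun m _ => hnn' m) fun m _ =>
      mul_le_mul_of_nonneg_left (powerTail_anti_exponent (by linarith) _) (by positivity)
  unfold powerTailLikelihood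
  rw [← Finset.mul_prod_erase _ _ (Finset.mem_univ i),
    ← Finset.mul_prod_erase _ _ (Finset.mem_univ i), ← hδ]
  calc _ = σ⁻¹ * (Metric.infDist y (range X.mulVec) ^ s * powerTail (a + s) (δ / σ)) *
        ∏ m ∈ Finset.univ.erase i, σ⁻¹ * powerTail (a + s) ((y m - X.mulVec β m) / σ) := by ring
    _ ≤ σ⁻¹ * (σ ^ s * powerTail a (δ / σ)) *
        ∏ m ∈ Finset.univ.erase i, σ⁻¹ * powerTail a ((y m - X.mulVec β m) / σ) := by
        refine mul_le_mul (mul_le_mul_of_nonneg_left hone (by positivity)) hrest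
          (Finset.prod_nonneg fun m _ => hnn' m) ?_
        exact mul_nonneg (by positivity) (mul_nonneg (by positivity) (powerTail_nonneg _ _))
    _ = _ := by ring

/-- Average over the observation of the weighted likelihood at a fixed small scale. -/
lemma lintegral_prod_powerTail_mul_powerTailLikelihood_le (X : Matrix (Fin n) (Fin k) ℝ)
    (β : Fin k → ℝ) {a σ : ℝ} (ha : 1 ≤ a) (hσ : 0 < σ) (hσ1 : σ ≤ 1) :
    ∫⁻ y, ENNReal.ofReal ((∏ i, powerTail (a + 2) (y i)) * powerTailLikelihood a X y σ β) ≤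
      (ENNReal.ofReal (2 ^ a) * ((∫⁻ u, ENNReal.ofReal (powerTail a u)) +
        ∫⁻ u, ENNReal.ofReal (powerTail 2 u))) ^ n *
        ENNReal.ofReal (∏ i, powerTail a (X.mulVec β i)) := by
  have hm : ∀ i, Measurable fun u => ENNReal.ofReal
      (powerTail (a + 2) u * (σ⁻¹ * powerTail a ((u - X.mulVec β i) / σ))) := fun i =>
    ((measurable_powerTail _).mul
      (((measurable_powerTail a).comp (by fun_prop)).const_mul _)).ennreal_ofReal
  unfold powerTailLikelihood
  simp_rw [← Finset.prod_mul_distrib]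
  simp_rw [ENNReal.ofReal_prod_of_nonneg fun i _ => mul_nonneg (powerTail_nonneg (a + 2) _)
    (mul_nonneg (inv_nonneg.2 hσ.le) (powerTail_nonneg a _))]
  rw [lintegral_pi_prod _ hm, ENNReal.ofReal_prod_of_nonneg fun i _ => powerTail_nonneg a _]
  refine (Finset.prod_le_prod' fun i _ =>
    lintegral_powerTail_mul_scaled_powerTail_le ha hσ hσ1 (X.mulVec β i)).trans (le_of_eq ?_)
  rw [Finset.prod_mul_distrib, Finset.prod_const, Finset.card_univ, Fintype.card_fin]

lemma isClosed_range_mulVec (X : Matrix (Fin n) (Fin k) ℝ) : IsClosed (range X.mulVec) := by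
  have h := Submodule.closed_of_finiteDimensional (LinearMap.range X.mulVecLin)
  convert h using 1
  ext y
  simp

/-- Finiteness over small scales, for almost every observation. -/
lemma ae_powerTailIntegral_Ioc_lt_top {X : Matrix (Fin n) (Fin k) ℝ} {W : (Fin k → ℝ) → ℝ}
    (hW0 : ∀ b, 0 ≤ W b) (hWm : Measurable W) {a s : ℝ} (ha : 1 < a) (hs : 0 < s)
    (hK : ∫⁻ b, ENNReal.ofReal (W b * ∏ i, powerTail a (X.mulVec b i)) < ⊤) :
    ∀ᵐ y : Fin n → ℝ, y ∉ range X.mulVec → powerTailIntegral (a + s) X W (Ioc 0 1) y < ⊤ := by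
  rcases Nat.eq_zero_or_pos n with rfl | hn
  · refine Filter.Eventually.of_forall fun y hy => (hy ⟨0, Subsingleton.elim _ _⟩).elim
  -- The distance power trades exponent `a + s` for `a` and gains `σ ^ s`; the tail product makes
  -- the average over `y` finite, uniformly in `σ ≤ 1`.
  set w : (Fin n → ℝ) → ℝ := fun y =>
    Metric.infDist y (range X.mulVec) ^ s * ∏ i, powerTail (a + 2) (y i) with hw
  have hw0 : ∀ y, 0 ≤ w y := fun y => mul_nonneg (Real.rpow_nonneg Metric.infDist_nonneg _)
    (Finset.prod_nonneg fun _ _ => powerTail_nonneg _ _)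
  have hwm : Measurable w :=
    ((Metric.continuous_infDist_pt _).measurable.pow_const s).mul
      (Finset.measurable_prod _ fun i _ =>
        (measurable_powerTail _).comp (measurable_pi_apply i))
  set μ : Measure (ℝ × (Fin k → ℝ)) := (volume.restrict (Ioc (0 : ℝ) 1)).prod volume with hμ
  have hLm := measurable_powerTailLikelihood (a + s) X
  have hLm' := measurable_powerTailLikelihood a X
  set G : (Fin n → ℝ) → ℝ × (Fin k → ℝ) → ENNReal := fun y p =>
    ENNReal.ofReal p.1⁻¹ * ENNReal.ofReal (W p.2 * powerTailLikelihood (a + s) X y p.1 p.2)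
    with hG
  have hGm : Measurable (Function.uncurry G) := by
    refine Measurable.mul (by fun_prop) (Measurable.ennreal_ofReal ?_)
    exact (hWm.comp (by fun_prop)).mul hLm
  have hint : ∀ y, powerTailIntegral (a + s) X W (Ioc 0 1) y = ∫⁻ p, G y p ∂μ := by
    intro y
    have hGy : Measurable (G y) := hGm.comp measurable_prodMk_left
    rw [hμ, lintegral_prod _ hGy.aemeasurable]
    refine lintegral_congr fun σ => ?_
    rw [← lintegral_const_mul' _ _ ENNReal.ofReal_ne_top]
  set H : (Fin n → ℝ) → ℝ × (Fin k → ℝ) → ENNReal := fun y p =>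
    ENNReal.ofReal (p.1 ^ (s - 1)) * ENNReal.ofReal (W p.2) * ENNReal.ofReal
      ((∏ i, powerTail (a + 2) (y i)) * powerTailLikelihood a X y p.1 p.2) with hH
  have hHm : Measurable (Function.uncurry H) := by
    refine Measurable.mul (Measurable.mul (by fun_prop) (hWm.comp (by fun_prop)).ennreal_ofReal)
      (Measurable.ennreal_ofReal (Measurable.mul ?_ hLm'))
    exact Finset.measurable_prod _ fun i _ => (measurable_powerTail _).comp (by fun_prop)
  have hGH : ∀ y, ENNReal.ofReal (w y) * ∫⁻ p, G y p ∂μ ≤ ∫⁻ p, H y p ∂μ := by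
    intro y
    rw [← lintegral_const_mul' _ _ ENNReal.ofReal_ne_top]
    refine lintegral_mono_ae ?_
    have hpos : ∀ᵐ p ∂μ, p.1 ∈ Ioc (0 : ℝ) 1 :=
      Measure.quasiMeasurePreserving_fst.ae (ae_restrict_mem measurableSet_Ioc)
    filter_upwards [hpos] with p hp
    obtain ⟨σ, β⟩ := p
    have hσ : 0 < σ := hp.1
    have h := infDist_rpow_mul_powerTailLikelihood_le hn X y β (a := a) hs.le hσ
    have hp0 : 0 ≤ ∏ i, powerTail (a + 2) (y i) :=
      Finset.prod_nonneg fun _ _ => powerTail_nonneg _ _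
    simp only [hG, hH]
    rw [← ENNReal.ofReal_mul (by positivity), ← ENNReal.ofReal_mul (hw0 y),
      ← ENNReal.ofReal_mul (by positivity),
      ← ENNReal.ofReal_mul (mul_nonneg (by positivity) (hW0 _))]
    refine ENNReal.ofReal_le_ofReal ?_
    calc w y * (σ⁻¹ * (W β * powerTailLikelihood (a + s) X y σ β))
        = σ⁻¹ * W β * (∏ i, powerTail (a + 2) (y i)) *
          (Metric.infDist y (range X.mulVec) ^ s * powerTailLikelihood (a + s) X y σ β) := by
          simp only [hw]; ring
      _ ≤ σ⁻¹ * W β * (∏ i, powerTail (a + 2) (y i)) *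
          (σ ^ s * powerTailLikelihood a X y σ β) :=
          mul_le_mul_of_nonneg_left h (mul_nonneg (mul_nonneg (by positivity) (hW0 _)) hp0)
      _ = _ := by rw [Real.rpow_sub hσ, Real.rpow_one]; ring
  set C : ENNReal := (ENNReal.ofReal (2 ^ a) * ((∫⁻ u, ENNReal.ofReal (powerTail a u)) +
        ∫⁻ u, ENNReal.ofReal (powerTail 2 u))) ^ n with hC
  have hCtop : C < ⊤ := ENNReal.pow_lt_top (ENNReal.mul_lt_top ENNReal.ofReal_lt_top
    (ENNReal.add_lt_top.2 ⟨lintegral_powerTail_lt_top ha,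
      lintegral_powerTail_lt_top (by norm_num)⟩))
  have hfin : ∫⁻ y, ENNReal.ofReal (w y) * ∫⁻ p, G y p ∂μ < ⊤ := by
    calc ∫⁻ y, ENNReal.ofReal (w y) * ∫⁻ p, G y p ∂μ
        ≤ ∫⁻ y, ∫⁻ p, H y p ∂μ := lintegral_mono hGH
      _ = ∫⁻ p, (∫⁻ y, H y p) ∂μ := lintegral_lintegral_swap hHm.aemeasurable
      _ ≤ ∫⁻ p, (C * ENNReal.ofReal (p.1 ^ (s - 1))) *
            ENNReal.ofReal (W p.2 * ∏ i, powerTail a (X.mulVec p.2 i)) ∂μ := by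
          refine lintegral_mono_ae ?_
          have hpos : ∀ᵐ p ∂μ, p.1 ∈ Ioc (0 : ℝ) 1 :=
            Measure.quasiMeasurePreserving_fst.ae (ae_restrict_mem measurableSet_Ioc)
          filter_upwards [hpos] with p hp
          simp only [hH]
          rw [lintegral_const_mul' _ _ (ENNReal.mul_ne_top ENNReal.ofReal_ne_top
            ENNReal.ofReal_ne_top), ENNReal.ofReal_mul (hW0 _)]
          refine (mul_le_mul_right
            (lintegral_prod_powerTail_mul_powerTailLikelihood_le X p.2 ha.le hp.1 hp.2) _).trans
            (le_of_eq ?_)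
          rw [← hC]; ring
      _ = (∫⁻ σ in Ioc (0 : ℝ) 1, C * ENNReal.ofReal (σ ^ (s - 1))) *
            ∫⁻ b, ENNReal.ofReal (W b * ∏ i, powerTail a (X.mulVec b i)) := by
          refine lintegral_prod_mul (f := fun σ : ℝ => C * ENNReal.ofReal (σ ^ (s - 1)))
            (g := fun b => ENNReal.ofReal (W b * ∏ i, powerTail a (X.mulVec b i)))
            (Measurable.aemeasurable (by fun_prop)) (Measurable.aemeasurable ?_)
          exact (hWm.mul (Finset.measurable_prod _ fun i _ =>
            (measurable_powerTail a).comp (measurable_mulVec X i))).ennreal_ofReal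
      _ < ⊤ := by
          refine ENNReal.mul_lt_top ?_ hK
          rw [lintegral_const_mul' _ _ hCtop.ne]
          refine ENNReal.mul_lt_top hCtop ?_
          have hI : IntegrableOn (fun σ : ℝ => σ ^ (s - 1)) (Ioc 0 1) :=
            (intervalIntegrable_iff_integrableOn_Ioc_of_le zero_le_one).1
              (intervalIntegral.intervalIntegrable_rpow' (by linarith))
          exact hI.lintegral_lt_top
  have hmeas : Measurable fun y => ENNReal.ofReal (w y) * ∫⁻ p, G y p ∂μ :=
    hwm.ennreal_ofReal.mul hGm.lintegral_prod_right
  filter_upwards [ae_lt_top hmeas hfin.ne] with y hy hyX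
  rw [hint]
  -- The column space is closed, so the weight is positive off it and can be divided out.
  have hwpos : 0 < w y := by
    refine mul_pos (Real.rpow_pos_of_pos ?_ _) (Finset.prod_pos fun _ _ => powerTail_pos _ _)
    exact ((isClosed_range_mulVec X).notMem_iff_infDist_pos ⟨_, mem_range_self 0⟩).1 hyX
  exact ENNReal.lt_top_of_mul_ne_top_right hy.ne (by simpa using hwpos)

/-! ### All scales and all moment orders at once. -/

/-- Finiteness of the integrated likelihood for almost every observation. -/
lemma ae_powerTailIntegral_Ioi_lt_top {X : Matrix (Fin n) (Fin k) ℝ} {W : (Fin k → ℝ) → ℝ}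
    (hW0 : ∀ b, 0 ≤ W b) (hWm : Measurable W) {a s r : ℝ} (ha : 1 < a) (hs : 0 < s)
    (hWr : ∀ σ : ℝ, 0 < σ → ∀ b, W (σ • b) = σ ^ r * W b)
    (hK : ∫⁻ b, ENNReal.ofReal (W b * ∏ i, powerTail a (X.mulVec b i)) < ⊤)
    (hr : r < n - k) :
    ∀ᵐ y : Fin n → ℝ, y ∉ range X.mulVec → powerTailIntegral (a + s) X W (Ioi 0) y < ⊤ := by
  filter_upwards [ae_powerTailIntegral_Ioc_lt_top hW0 hWm ha hs hK] with y hy hyX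
  have hK' : ∫⁻ b, ENNReal.ofReal (W b * ∏ i, powerTail (a + s) (X.mulVec b i)) < ⊤ := by
    refine lt_of_le_of_lt (lintegral_mono fun b => ENNReal.ofReal_le_ofReal
      (mul_le_mul_of_nonneg_left (Finset.prod_le_prod (fun _ _ => powerTail_nonneg _ _)
        fun i _ => powerTail_anti_exponent (by linarith) _) (hW0 b))) hK
  have h1 := powerTailIntegral_Ioi_one_lt_top hW0 hWm (by linarith) hWr hK' hr y
  unfold powerTailIntegral at h1 hy ⊢
  rw [← Ioc_union_Ioi_eq_Ioi (zero_le_one (α := ℝ)),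
    lintegral_union measurableSet_Ioi (Ioc_disjoint_Ioi le_rfl)]
  exact ENNReal.add_lt_top.2 ⟨hy hyX, h1⟩

/-- Simultaneous finiteness of the normalising constant and of all moments in the stated range,
for almost every observation. -/
lemma ae_powerTailIntegral_moment_lt_top {X : Matrix (Fin n) (Fin k) ℝ} (hX : X.rank = k) :
    ∀ᵐ y : Fin n → ℝ, y ∉ range X.mulVec →
      powerTailIntegral 3 X (fun _ => 1) (Ioi 0) y < ⊤ ∧
      ∀ (j : Fin k) (r : ℝ), 0 ≤ r →
        r < min ((n : ℝ) - k) ((n : ℝ) - k - singularityIndex X j + 2) →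
        powerTailIntegral 3 X (fun b => |b j| ^ r) (Ioi 0) y < ⊤ := by
  have hzero : ∀ᵐ y : Fin n → ℝ, y ∉ range X.mulVec →
      powerTailIntegral 3 X (fun _ => 1) (Ioi 0) y < ⊤ := by
    have hkn : k ≤ n := by rw [← hX]; exact X.rank_le_height
    rcases hkn.eq_or_lt with rfl | hlt
    -- For `k = n` the column space is everything, so no observation remains.
    · refine Filter.Eventually.of_forall fun y hy => (hy ?_).elim
      have hsurj : Function.Surjective X.mulVecLin := by
        rw [← LinearMap.range_eq_top]
        apply Submodule.eq_top_of_finrank_eq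
        rw [Module.finrank_fin_fun]
        exact hX
      obtain ⟨b, hb⟩ := hsurj y
      exact ⟨b, hb⟩
    · have h := ae_powerTailIntegral_Ioi_lt_top (X := X) (W := fun _ => 1) (a := 2) (s := 1)
        (r := 0) (fun _ => zero_le_one) measurable_const (by norm_num) one_pos (by simp)
        (by simpa using lintegral_prod_powerTail_lt_top hX (a := 2) (by norm_num))
        (by rw [sub_pos]; exact_mod_cast hlt)
      norm_num at h ⊢
      exact h
  -- Rational orders give countably many null sets, hence one null set for all real orders.
  have hrat : ∀ j : Fin k, ∀ q : ℚ, ∀ᵐ y : Fin n → ℝ, y ∉ range X.mulVec → 0 ≤ (q : ℝ) →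
      (q : ℝ) < min ((n : ℝ) - k) ((n : ℝ) - k - singularityIndex X j + 2) →
      powerTailIntegral 3 X (fun b => |b j| ^ (q : ℝ)) (Ioi 0) y < ⊤ := by
    intro j q
    by_cases hq : 0 ≤ (q : ℝ) ∧
      (q : ℝ) < min ((n : ℝ) - k) ((n : ℝ) - k - singularityIndex X j + 2)
    swap
    · exact Filter.Eventually.of_forall fun y _ h1 h2 => (hq ⟨h1, h2⟩).elim
    obtain ⟨hq0, hqlt⟩ := hq
    obtain ⟨hq1, hq2⟩ := lt_min_iff.1 hqlt
    have hple : (singularityIndex X j : ℝ) ≤ n - k := by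
      have hkn : k ≤ n := by rw [← hX]; exact X.rank_le_height
      rw [← Nat.cast_sub hkn]
      exact_mod_cast singularityIndex_le X j
    set g : ℝ := (n : ℝ) - k - singularityIndex X j with hg
    -- With `g ≥ 0` this choice ensures `q + 1 < (3 - s) * (g + 1)` and `3 - s ≥ 2`, while the total
    -- exponent stays 3.
    set s : ℝ := min 1 ((g + 2 - q) / 2) with hs
    have hs0 : 0 < s := lt_min one_pos (by linarith)
    have hs1 : s ≤ 1 := min_le_left _ _
    have hs2 : s ≤ (g + 2 - q) / 2 := min_le_right _ _
    have hK := lintegral_moment_mul_prod_powerTail_lt_top hX j (a := 3 - s) (by linarith) hq0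
      (by nlinarith)
    have h := ae_powerTailIntegral_Ioi_lt_top (X := X) (W := fun b => |b j| ^ (q : ℝ))
      (a := 3 - s) (s := s) (r := q) (fun b => by positivity) (by fun_prop) (by linarith) hs0
      (fun σ hσ b => by
        rw [Pi.smul_apply, smul_eq_mul, abs_mul, abs_of_pos hσ,
          Real.mul_rpow hσ.le (abs_nonneg _)]) hK hq1
    rw [sub_add_cancel] at h
    filter_upwards [h] with y hy hyX _ _ using hy hyX
  filter_upwards [hzero, ae_all_iff.2 fun j => ae_all_iff.2 (hrat j)] with y h0 hq hyX
  refine ⟨h0 hyX, fun j r hr0 hr => ?_⟩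
  obtain ⟨q, hrq, hqlt⟩ := exists_rat_btwn hr
  have h1 := hq j q hyX (hr0.trans hrq.le) hqlt
  have h2 := h0 hyX
  refine lt_of_le_of_lt ?_ (ENNReal.add_lt_top.2 ⟨h2, h1⟩)
  simp only [powerTailIntegral]
  have hLm : ∀ σ, Measurable fun β => powerTailLikelihood 3 X y σ β := fun σ =>
    (measurable_powerTailLikelihood 3 X).comp
      (by fun_prop : Measurable fun β : Fin k → ℝ => (y, σ, β))
  have hLm2 : Measurable fun p : ℝ × (Fin k → ℝ) => powerTailLikelihood 3 X y p.1 p.2 :=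
    (measurable_powerTailLikelihood 3 X).comp
      (by fun_prop : Measurable fun p : ℝ × (Fin k → ℝ) => (y, p.1, p.2))
  have hm : Measurable fun σ : ℝ => ENNReal.ofReal σ⁻¹ *
      ∫⁻ β, ENNReal.ofReal (1 * powerTailLikelihood 3 X y σ β) :=
    Measurable.mul (by fun_prop) (Measurable.lintegral_prod_right (hLm2.const_mul 1).ennreal_ofReal)
  rw [← lintegral_add_left hm]
  refine setLIntegral_mono' measurableSet_Ioi fun σ hσ => ?_
  rw [← mul_add, ← lintegral_add_left ((hLm σ).const_mul 1).ennreal_ofReal]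
  gcongr with β
  have hL := powerTailLikelihood_nonneg 3 X y hσ β
  rw [← ENNReal.ofReal_add (by linarith) (mul_nonneg (by positivity) hL), ← add_mul]
  refine ENNReal.ofReal_le_ofReal (mul_le_mul_of_nonneg_right ?_ hL)
  -- `|β j| ^ r ≤ 1 + |β j| ^ q` whenever `0 ≤ r ≤ q`.
  rcases le_total |β j| 1 with h | h
  · linarith [Real.rpow_le_one (abs_nonneg _) h hr0, Real.rpow_nonneg (abs_nonneg (β j)) q]
  · linarith [Real.rpow_le_rpow_of_exponent_le h hrq.le]

/-! ### Uniform bounds for the Student and two-piece densities. -/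

@[fun_prop]
-- `1 / Γ` is entire, so `Γ` is the pointwise inverse of a continuous function.
lemma Real.measurable_Gamma : Measurable Real.Gamma := by
  have h : Measurable fun s : ℂ => ((Complex.Gamma s)⁻¹)⁻¹ :=
    Complex.differentiable_one_div_Gamma.continuous.measurable.inv
  simp only [inv_inv] at h
  exact Complex.measurable_re.comp (h.comp Complex.measurable_ofReal)

/-- Log-convexity of `Γ` at the midpoint of `x` and `x + 1`. -/
lemma Real.Gamma_add_half_le {x : ℝ} (hx : 0 < x) :
    Real.Gamma (x + 1 / 2) ≤ Real.sqrt x * Real.Gamma x := by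
  have h := Real.Gamma_mul_add_mul_le_rpow_Gamma_mul_rpow_Gamma hx (by linarith : 0 < x + 1)
    (by norm_num : (0 : ℝ) < 1 / 2) (by norm_num : (0 : ℝ) < 1 / 2) (by norm_num)
  have hG := (Real.Gamma_pos_of_pos hx).le
  rw [Real.Gamma_add_one hx.ne', Real.mul_rpow hx.le hG, mul_left_comm,
    ← Real.rpow_add (Real.Gamma_pos_of_pos hx), ← Real.sqrt_eq_rpow] at h
  norm_num at h
  convert h using 2
  ring

/-- The normalising constant of the Student density. -/
noncomputable def studentConst (ν : ℝ) : ℝ :=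
  Real.Gamma ((ν + 1) / 2) / (Real.sqrt (Real.pi * ν) * Real.Gamma (ν / 2))

lemma studentConst_pos {ν : ℝ} (hν : 0 < ν) : 0 < studentConst ν := by
  unfold studentConst
  have h1 := Real.Gamma_pos_of_pos (by linarith : 0 < (ν + 1) / 2)
  have h2 := Real.Gamma_pos_of_pos (by linarith : 0 < ν / 2)
  positivity

lemma studentConst_le_one {ν : ℝ} (hν : 0 < ν) : studentConst ν ≤ 1 := by
  unfold studentConst
  have h2 := Real.Gamma_pos_of_pos (by linarith : 0 < ν / 2)
  rw [div_le_one (by positivity)]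
  have h := Real.Gamma_add_half_le (by linarith : 0 < ν / 2)
  rw [show ν / 2 + 1 / 2 = (ν + 1) / 2 by ring] at h
  refine h.trans (mul_le_mul_of_nonneg_right (Real.sqrt_le_sqrt ?_) h2.le)
  nlinarith [Real.pi_gt_three]

lemma studentPDF_eq (ν x : ℝ) :
    studentPDF ν x = studentConst ν * (1 + x ^ 2 / ν) ^ (-((ν + 1) / 2)) := rfl

lemma studentPDF_pos {ν : ℝ} (hν : 0 < ν) (x : ℝ) : 0 < studentPDF ν x := by
  rw [studentPDF_eq]
  have := studentConst_pos hν
  positivity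

lemma studentPDF_le_of_abs_le {ν : ℝ} (hν : 0 < ν) {x x' : ℝ} (h : |x| ≤ |x'|) :
    studentPDF ν x' ≤ studentPDF ν x := by
  rw [studentPDF_eq, studentPDF_eq]
  refine mul_le_mul_of_nonneg_left ?_ (studentConst_pos hν).le
  refine Real.rpow_le_rpow_of_nonpos (by positivity) ?_ (by linarith)
  have := sq_le_sq.2 h
  gcongr

/-- Student densities with at least two degrees of freedom have a common cubic tail bound. -/
lemma studentPDF_le_powerTail {ν : ℝ} (hν : 2 ≤ ν) (x : ℝ) :
    studentPDF ν x ≤ 6 ^ (3 / 2 : ℝ) * powerTail 3 x := by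
  have hν0 : 0 < ν := by linarith
  have hx : 0 ≤ x ^ 2 / ν := by positivity
  -- Bernoulli's inequality, with exponent at least 1 because `ν ≥ 2`; raising to the power `-3/2`
  -- yields the cubic tail.
  have h1 : 1 + x ^ 2 / 3 ≤ (1 + x ^ 2 / ν) ^ ((ν + 1) / 3) := by
    refine le_trans ?_ (one_add_mul_self_le_rpow_one_add (by linarith : -1 ≤ x ^ 2 / ν)
      (by linarith : 1 ≤ (ν + 1) / 3))
    have : (ν + 1) / 3 * (x ^ 2 / ν) = x ^ 2 / 3 + x ^ 2 / ν / 3 := by field_simp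
    linarith
  have h2 : (1 + |x|) ^ 2 / 6 ≤ 1 + x ^ 2 / 3 := by
    have := sq_abs x
    nlinarith [sq_nonneg (|x| - 1)]
  have h3 : (1 + x ^ 2 / ν) ^ (-((ν + 1) / 2)) ≤ ((1 + |x|) ^ 2 / 6) ^ (-(3 / 2) : ℝ) := by
    have : (1 + x ^ 2 / ν) ^ (-((ν + 1) / 2)) =
        ((1 + x ^ 2 / ν) ^ ((ν + 1) / 3)) ^ (-(3 / 2) : ℝ) := by
      rw [← Real.rpow_mul (by positivity)]; congr 1; ring
    rw [this]
    exact Real.rpow_le_rpow_of_nonpos (by positivity) (h2.trans h1) (by norm_num)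
  have h4 : ((1 + |x|) ^ 2 / 6) ^ (-(3 / 2) : ℝ) = 6 ^ (3 / 2 : ℝ) * powerTail 3 x := by
    unfold powerTail
    rw [Real.div_rpow (by positivity) (by norm_num), ← Real.rpow_natCast (1 + |x|),
      ← Real.rpow_mul (by positivity), Real.rpow_neg (by norm_num : (0 : ℝ) ≤ 6)]
    norm_num
    ring
  rw [studentPDF_eq, ← h4]
  calc _ ≤ 1 * (1 + x ^ 2 / ν) ^ (-((ν + 1) / 2)) :=
        mul_le_mul_of_nonneg_right (studentConst_le_one hν0) (by positivity)
    _ ≤ _ := by rw [one_mul]; exact h3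

lemma twoPieceMean_eq (γ ν : ℝ) :
    twoPieceMean γ ν = 2 * (ν / (ν - 1)) * studentConst ν * (γ - 1 / γ) := by
  unfold twoPieceMean studentConst
  congr 1
  rw [← mul_div_assoc 2 ν, div_mul_div_comm]
  congr 1
  ring

lemma abs_twoPieceMean_le {γ ν : ℝ} (hγ : 0 < γ) (hν : 2 ≤ ν) :
    |twoPieceMean γ ν| ≤ 4 * (γ + 1 / γ) := by
  have hc0 := studentConst_pos (by linarith : 0 < ν)
  have hc1 := studentConst_le_one (by linarith : 0 < ν)
  have h1 : 0 ≤ ν / (ν - 1) := div_nonneg (by linarith) (by linarith)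
  have h2 : ν / (ν - 1) ≤ 2 := by rw [div_le_iff₀ (by linarith)]; linarith
  have h3 : |γ - 1 / γ| ≤ γ + 1 / γ := by
    have : 0 < 1 / γ := by positivity
    rw [abs_le]; constructor <;> linarith
  rw [twoPieceMean_eq, abs_mul, abs_of_nonneg (by positivity)]
  refine mul_le_mul ?_ h3 (abs_nonneg _) (by norm_num)
  nlinarith

lemma ctptPDF_pos {γ ν : ℝ} (hγ : 0 < γ) (hν : 0 < ν) (ε : ℝ) : 0 < ctptPDF γ ν ε := by
  unfold ctptPDF
  refine mul_pos (by positivity) ?_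
  split_ifs <;> exact studentPDF_pos hν _

/-- The cubic tail bound is uniform over a compact range of skewness parameters. -/
lemma exists_ctptPDF_le_powerTail {a b : ℝ} (ha : 0 < a) :
    ∃ C : ℝ, 0 ≤ C ∧ ∀ γ ∈ Icc a b, ∀ ν, 2 < ν → ∀ ε, ctptPDF γ ν ε ≤ C * powerTail 3 ε := by
  set G : ℝ := max 1 (max b (1 / a)) with hG
  have hG1 : 1 ≤ G := le_max_left _ _
  refine ⟨6 ^ (3 / 2 : ℝ) * ((1 + 8 * G) * G) ^ (3 : ℝ), by positivity, ?_⟩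
  intro γ hγ ν hν ε
  have hγ0 : 0 < γ := ha.trans_le hγ.1
  have hγG : γ ≤ G := hγ.2.trans ((le_max_left _ _).trans (le_max_right _ _))
  have hγG' : 1 / γ ≤ G := (one_div_le_one_div_of_le ha hγ.1).trans
    ((le_max_right _ _).trans (le_max_right _ _))
  set m := twoPieceMean γ ν with hm
  have hmG : |m| ≤ 8 * G := (abs_twoPieceMean_le hγ0 hν.le).trans (by linarith)
  -- Both pieces evaluate the Student density at a point `x` of this kind, since `G` bounds `γ` and
  -- `1 / γ`; the centring moves `ε` by at most `8 * G`.
  have key : ∀ x, |ε + m| ≤ G * |x| →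
      studentPDF ν x ≤ 6 ^ (3 / 2 : ℝ) * ((1 + 8 * G) * G) ^ (3 : ℝ) * powerTail 3 ε := by
    intro x hx
    refine (studentPDF_le_powerTail hν.le x).trans ?_
    rw [mul_assoc]
    refine mul_le_mul_of_nonneg_left ?_ (by positivity)
    have hε : 1 + |ε| ≤ (1 + 8 * G) * G * (1 + |x|) := by
      have h1 : |ε| ≤ |ε + m| + |m| := by
        have := abs_sub (ε + m) m
        rwa [add_sub_cancel_right] at this
      have h2 := abs_nonneg x
      have hG0 : 0 ≤ G := by linarith
      nlinarith [mul_nonneg hG0 h2, mul_nonneg (mul_nonneg hG0 hG0) h2]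
    unfold powerTail
    rw [Real.rpow_neg (by positivity), Real.rpow_neg (by positivity), ← div_eq_mul_inv,
      le_div_iff₀ (by positivity), inv_mul_le_iff₀ (by positivity),
      ← Real.mul_rpow (by positivity) (by positivity)]
    exact Real.rpow_le_rpow (by positivity) (by linarith) (by norm_num)
  have hfac : 2 / (γ + 1 / γ) ≤ 1 := by
    rw [div_le_one (by positivity)]
    have : γ * (1 / γ) = 1 := by field_simp
    nlinarith [sq_nonneg (γ - 1 / γ), (by positivity : 0 < 1 / γ)]
  unfold ctptPDF
  rw [← hm]
  have hnn : ∀ x, 0 ≤ studentPDF ν x := fun x => (studentPDF_pos (by linarith) x).le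
  split_ifs
  · refine (mul_le_of_le_one_left (hnn _) hfac).trans (key _ ?_)
    rw [abs_div, abs_of_pos hγ0, mul_div_assoc', le_div_iff₀ hγ0, mul_comm]
    exact mul_le_mul_of_nonneg_right hγG (abs_nonneg _)
  · refine (mul_le_of_le_one_left (hnn _) hfac).trans (key _ ?_)
    rw [abs_mul, abs_of_pos hγ0, ← mul_assoc]
    refine le_mul_of_one_le_left (abs_nonneg _) ?_
    rwa [← div_le_iff₀ hγ0]

/-- A lower bound of the two-piece density on `[-1, 1]`. -/
noncomputable def ctptLower (γ ν : ℝ) : ℝ :=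
  2 / (γ + 1 / γ) * studentPDF ν ((1 + |twoPieceMean γ ν|) * (γ + 1 / γ))

lemma ctptLower_pos {γ ν : ℝ} (hγ : 0 < γ) (hν : 0 < ν) : 0 < ctptLower γ ν :=
  mul_pos (by positivity) (studentPDF_pos hν _)

/-- `γ + 1 / γ` exceeds both scale factors, so one argument serves both pieces, and the Student
density decreases in `|x|`. -/
lemma ctptLower_le {γ ν ε : ℝ} (hγ : 0 < γ) (hν : 0 < ν) (hε : |ε| ≤ 1) :
    ctptLower γ ν ≤ ctptPDF γ ν ε := by
  have h1 : |ε + twoPieceMean γ ν| ≤ 1 + |twoPieceMean γ ν| :=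
    (abs_add_le _ _).trans (by linarith)
  have hi : 0 < 1 / γ := by positivity
  refine mul_le_mul_of_nonneg_left ?_ (by positivity)
  split_ifs
  all_goals
    refine studentPDF_le_of_abs_le hν ?_
    rw [abs_of_nonneg (by positivity : 0 ≤ (1 + |twoPieceMean γ ν|) * (γ + 1 / γ))]
  · rw [abs_div, abs_of_pos hγ, div_eq_mul_one_div]
    exact mul_le_mul h1 (by linarith) hi.le (by positivity)
  · rw [abs_mul, abs_of_pos hγ, mul_comm]
    exact mul_le_mul h1 (by linarith) hγ.le (by positivity)

/-! ### Measurability and integration against the prior. -/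

@[fun_prop]
lemma Measurable.studentPDF {α : Type*} [MeasurableSpace α] {f g : α → ℝ} (hf : Measurable f)
    (hg : Measurable g) : Measurable fun x => studentPDF (f x) (g x) := by
  unfold _root_.studentPDF
  fun_prop

@[fun_prop]
lemma Measurable.twoPieceMean {α : Type*} [MeasurableSpace α] {f g : α → ℝ} (hf : Measurable f)
    (hg : Measurable g) : Measurable fun x => twoPieceMean (f x) (g x) := by
  unfold _root_.twoPieceMean
  fun_prop

lemma Measurable.ctptPDF {α : Type*} [MeasurableSpace α] {f g h : α → ℝ} (hf : Measurable f)
    (hg : Measurable g) (hh : Measurable h) :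
    Measurable fun x => ctptPDF (f x) (g x) (h x) := by
  unfold _root_.ctptPDF
  refine Measurable.mul (by fun_prop) (Measurable.ite ?_ (by fun_prop) (by fun_prop))
  exact measurableSet_le (by fun_prop) hh

lemma measurable_ctptLower : Measurable fun p : ℝ × ℝ => ctptLower p.1 p.2 := by
  unfold ctptLower
  fun_prop

lemma measurable_ctptLikelihood (X : Matrix (Fin n) (Fin k) ℝ) (y : Fin n → ℝ) :
    Measurable (ctptLikelihood X y) := by
  unfold ctptLikelihood
  refine Finset.measurable_prod _ fun i _ => Measurable.mul (by fun_prop) ?_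
  exact Measurable.ctptPDF (by fun_prop) (by fun_prop) (by fun_prop)

instance : SFinite scalePrior := by
  unfold scalePrior; infer_instance

instance : NeZero scalePrior := by
  refine ⟨fun h => ?_⟩
  unfold scalePrior at h
  rw [withDensity_eq_zero_iff (by fun_prop)] at h
  have h2 : ∀ᵐ σ ∂(volume.restrict (Ioi (0 : ℝ))), σ ∈ Ioi (0 : ℝ) :=
    ae_restrict_mem measurableSet_Ioi
  have : (ae (volume.restrict (Ioi (0 : ℝ)))).NeBot := by
    rw [ae_neBot, ne_eq, Measure.restrict_eq_zero]; simp
  obtain ⟨σ, h1, h2⟩ := (h.and h2).exists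
  have : σ⁻¹ ≤ 0 := by simpa using h1
  exact absurd this (not_le.2 (inv_pos.2 h2))

lemma ae_scalePrior_pos : ∀ᵐ σ ∂scalePrior, 0 < σ :=
  (withDensity_absolutelyContinuous _ _).ae_le (ae_restrict_mem measurableSet_Ioi)

lemma lintegral_scalePrior {f : ℝ → ENNReal} (hf : Measurable f) :
    ∫⁻ σ, f σ ∂scalePrior = ∫⁻ σ in Ioi 0, ENNReal.ofReal σ⁻¹ * f σ := by
  unfold scalePrior
  rw [lintegral_withDensity_eq_lintegral_mul _ (by fun_prop) hf]
  rfl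

/-- The upper and the lower bounds of the likelihood both separate `(β, σ)` from `(γ, ν)`; Tonelli
then factors the integral. -/
lemma lintegral_ctptPrior_mul (Pγ Pν : Measure ℝ) [IsProbabilityMeasure Pγ]
    [IsProbabilityMeasure Pν] {F : (Fin k → ℝ) → ℝ → ENNReal} (hF : Measurable (Function.uncurry F))
    {G : ℝ × ℝ → ENNReal} (hG : Measurable G) :
    ∫⁻ θ, F θ.1 θ.2.1 * G θ.2.2 ∂(ctptPrior k Pγ Pν) =
      (∫⁻ σ in Ioi 0, ENNReal.ofReal σ⁻¹ * ∫⁻ β, F β σ) * ∫⁻ g, G g ∂(Pγ.prod Pν) := by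
  have hFβ : ∀ β, Measurable (F β) := fun β => hF.comp measurable_prodMk_left
  have hm : Measurable fun θ : (Fin k → ℝ) × ℝ × ℝ × ℝ => F θ.1 θ.2.1 * G θ.2.2 :=
    (hF.comp (by fun_prop : Measurable fun θ : (Fin k → ℝ) × ℝ × ℝ × ℝ => (θ.1, θ.2.1))).mul
      (hG.comp (by fun_prop))
  unfold ctptPrior
  rw [lintegral_prod _ hm.aemeasurable]
  have h1 : ∀ β, ∫⁻ z : ℝ × ℝ × ℝ, F β z.1 * G z.2 ∂(scalePrior.prod (Pγ.prod Pν)) =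
      (∫⁻ σ, F β σ ∂scalePrior) * ∫⁻ g, G g ∂(Pγ.prod Pν) := fun β =>
    lintegral_prod_mul (hFβ β).aemeasurable hG.aemeasurable
  simp_rw [h1]
  rw [lintegral_mul_const _ hF.lintegral_prod_right, lintegral_lintegral_swap hF.aemeasurable,
    lintegral_scalePrior hF.lintegral_prod_left]

lemma ae_ctptPrior {Pγ Pν : Measure ℝ} [IsProbabilityMeasure Pγ] [IsProbabilityMeasure Pν]
    {s : Set ℝ} (hs : ∀ᵐ γ ∂Pγ, γ ∈ s) (hν : ∀ᵐ ν ∂Pν, 2 < ν) :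
    ∀ᵐ θ ∂(ctptPrior k Pγ Pν), 0 < θ.2.1 ∧ θ.2.2.1 ∈ s ∧ 2 < θ.2.2.2 := by
  have h1 : ∀ᵐ g ∂(Pγ.prod Pν), g.1 ∈ s ∧ 2 < g.2 :=
    (Measure.quasiMeasurePreserving_fst.ae hs).and (Measure.quasiMeasurePreserving_snd.ae hν)
  have h2 : ∀ᵐ z ∂(scalePrior.prod (Pγ.prod Pν)), 0 < z.1 ∧ z.2.1 ∈ s ∧ 2 < z.2.2 :=
    (Measure.quasiMeasurePreserving_fst.ae ae_scalePrior_pos).and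
      (Measure.quasiMeasurePreserving_snd.ae h1)
  exact Measure.quasiMeasurePreserving_snd.ae h2

lemma IsSkewnessPrior.exists_ae_mem {P : Measure ℝ} (h : IsSkewnessPrior P) :
    ∃ a b : ℝ, 0 < a ∧ ∀ᵐ γ ∂P, γ ∈ Icc a b := by
  obtain ⟨hP, a, b, ha, -, -, hab⟩ := h
  exact ⟨a, b, ha, (prob_compl_eq_zero_iff measurableSet_Icc).2 hab⟩

lemma IsTailPrior.ae_gt {P : Measure ℝ} (h : IsTailPrior P) : ∀ᵐ ν ∂P, 2 < ν := by
  obtain ⟨hP, h2⟩ := h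
  exact (prob_compl_eq_zero_iff measurableSet_Ioi).2 h2

lemma ctptLikelihood_pos (X : Matrix (Fin n) (Fin k) ℝ) (y : Fin n → ℝ)
    {θ : (Fin k → ℝ) × ℝ × ℝ × ℝ} (hσ : 0 < θ.2.1) (hγ : 0 < θ.2.2.1) (hν : 2 < θ.2.2.2) :
    0 < ctptLikelihood X y θ :=
  Finset.prod_pos fun _ _ => mul_pos (inv_pos.2 hσ) (ctptPDF_pos hγ (by linarith) _)

lemma marginalLikelihood_pos (X : Matrix (Fin n) (Fin k) ℝ) (y : Fin n → ℝ)
    {Pγ Pν : Measure ℝ} (hγ : IsSkewnessPrior Pγ) (hν : IsTailPrior Pν) :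
    0 < marginalLikelihood X y Pγ Pν := by
  have := hγ.1
  have := hν.1
  obtain ⟨a, b, ha, hab⟩ := hγ.exists_ae_mem
  have hne : NeZero (ctptPrior k Pγ Pν) := by
    refine ⟨fun h => ?_⟩
    have h1 : ctptPrior k Pγ Pν univ = 0 := by rw [h]; rfl
    unfold ctptPrior at h1
    simp only [← univ_prod_univ, Measure.prod_prod, measure_univ, mul_one, mul_eq_zero,
      Measure.measure_univ_eq_zero] at h1
    exact h1.elim (NeZero.ne _) (NeZero.ne _)
  rw [pos_iff_ne_zero]
  intro h
  unfold marginalLikelihood at h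
  rw [lintegral_eq_zero_iff (measurable_ctptLikelihood X y).ennreal_ofReal] at h
  obtain ⟨θ, h1, hσ, hg, h2⟩ := (h.and (ae_ctptPrior hab hν.ae_gt)).exists
  have hpos := ctptLikelihood_pos X y hσ (ha.trans_le hg.1) h2
  simp at h1
  linarith

/-! ### Finite and infinite posterior integrals. -/

/-- Domination of weighted likelihood integrals by the cubic-tail model. -/
lemma lintegral_mul_ctptLikelihood_lt_top (X : Matrix (Fin n) (Fin k) ℝ) (y : Fin n → ℝ)
    {Pγ Pν : Measure ℝ} (hγ : IsSkewnessPrior Pγ) (hν : IsTailPrior Pν)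
    {W : (Fin k → ℝ) → ℝ} (hW0 : ∀ b, 0 ≤ W b) (hWm : Measurable W)
    (h : powerTailIntegral 3 X W (Ioi 0) y < ⊤) :
    ∫⁻ θ, ENNReal.ofReal (W θ.1 * ctptLikelihood X y θ) ∂(ctptPrior k Pγ Pν) < ⊤ := by
  have := hγ.1
  have := hν.1
  obtain ⟨a, b, ha, hab⟩ := hγ.exists_ae_mem
  obtain ⟨C, hC, hCle⟩ := exists_ctptPDF_le_powerTail (b := b) ha
  have hLm : Measurable fun p : (Fin k → ℝ) × ℝ =>
      ENNReal.ofReal (W p.1 * powerTailLikelihood 3 X y p.2 p.1) :=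
    ((hWm.comp measurable_fst).mul ((measurable_powerTailLikelihood 3 X).comp
      (by fun_prop : Measurable fun p : (Fin k → ℝ) × ℝ => (y, p.2, p.1)))).ennreal_ofReal
  have hle : ∀ᵐ θ ∂(ctptPrior k Pγ Pν), ENNReal.ofReal (W θ.1 * ctptLikelihood X y θ) ≤
      ENNReal.ofReal (W θ.1 * powerTailLikelihood 3 X y θ.2.1 θ.1) * ENNReal.ofReal (C ^ n) := by
    filter_upwards [ae_ctptPrior hab hν.ae_gt] with θ hθ
    obtain ⟨hσ, hg, h2⟩ := hθ
    rw [← ENNReal.ofReal_mul' (by positivity), mul_assoc]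
    refine ENNReal.ofReal_le_ofReal (mul_le_mul_of_nonneg_left ?_ (hW0 _))
    have hCn : C ^ n = ∏ _i : Fin n, C := by simp
    unfold ctptLikelihood powerTailLikelihood
    rw [hCn, ← Finset.prod_mul_distrib]
    refine Finset.prod_le_prod (fun i _ => mul_nonneg (by positivity)
      (ctptPDF_pos (ha.trans_le hg.1) (by linarith) _).le) fun i _ => ?_
    rw [mul_assoc, mul_comm (powerTail _ _)]
    exact mul_le_mul_of_nonneg_left (hCle _ hg _ h2 _) (by positivity)
  refine lt_of_le_of_lt (lintegral_mono_ae hle) ?_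
  rw [lintegral_ctptPrior_mul Pγ Pν (F := fun β σ =>
    ENNReal.ofReal (W β * powerTailLikelihood 3 X y σ β)) hLm
    (G := fun _ => ENNReal.ofReal (C ^ n)) measurable_const]
  exact ENNReal.mul_lt_top h (by simp)

lemma posteriorAbsMoment_eq (X : Matrix (Fin n) (Fin k) ℝ) (y : Fin n → ℝ) (Pγ Pν : Measure ℝ)
    (j : Fin k) (r : ℝ) :
    posteriorAbsMoment X y Pγ Pν j r = (marginalLikelihood X y Pγ Pν)⁻¹ *
      ∫⁻ θ, ENNReal.ofReal (|θ.1 j| ^ r * ctptLikelihood X y θ) ∂(ctptPrior k Pγ Pν) := by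
  unfold posteriorAbsMoment ctptPosterior
  rw [lintegral_smul_measure, lintegral_withDensity_eq_lintegral_mul _
    (measurable_ctptLikelihood X y).ennreal_ofReal (by fun_prop)]
  simp only [smul_eq_mul, Pi.mul_apply]
  congr 1
  refine lintegral_congr fun θ => ?_
  rw [mul_comm, ENNReal.ofReal_mul (by positivity)]

/-- The moments of order at least `n - k` of the unnormalised posterior are infinite. -/
lemma lintegral_moment_mul_ctptLikelihood_eq_top (X : Matrix (Fin n) (Fin k) ℝ) (y : Fin n → ℝ)
    {Pγ Pν : Measure ℝ} (hγ : IsSkewnessPrior Pγ) (hν : IsTailPrior Pν) (j : Fin k) {r : ℝ}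
    (hr0 : 0 ≤ r) (hr : (n : ℝ) - k ≤ r) :
    ∫⁻ θ, ENNReal.ofReal (|θ.1 j| ^ r * ctptLikelihood X y θ) ∂(ctptPrior k Pγ Pν) = ⊤ := by
  have := hγ.1
  have := hν.1
  obtain ⟨a, b, ha, hab⟩ := hγ.exists_ae_mem
  set M : ℝ := ∑ i, |y i| with hM
  have hM0 : 0 ≤ M := Finset.sum_nonneg fun _ _ => abs_nonneg _
  set T : ℝ := ∑ i, ∑ l, |X i l| with hT
  have hT0 : 0 ≤ T := Finset.sum_nonneg fun _ _ => Finset.sum_nonneg fun _ _ => abs_nonneg _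
  set τ : ℝ := 1 / (2 * (T + 1)) with hτ
  have hτ0 : 0 < τ := by positivity
  have hTτ : T * τ ≤ 1 / 2 := by
    rw [hτ, mul_one_div, div_le_div_iff₀ (by positivity) (by norm_num)]; linarith
  -- On `B` both `|y i|` and `|(X β) i|` are at most `σ / 2`, so standardised residuals lie in `[-1,
  -- 1]`. The `+ 1` also forces `σ ≥ 1`.
  set B : Set ((Fin k → ℝ) × ℝ) :=
    {p | 2 * M + 1 < p.2 ∧ ∀ l, τ * p.2 / 2 ≤ p.1 l ∧ p.1 l ≤ τ * p.2} with hB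
  have hBm : MeasurableSet B := by
    have : B = {p | 2 * M + 1 < p.2} ∩
        ⋂ l, {p | τ * p.2 / 2 ≤ p.1 l} ∩ {p | p.1 l ≤ τ * p.2} := by
      ext p; simp [hB]
    rw [this]
    refine (measurableSet_lt measurable_const measurable_snd).inter ?_
    exact MeasurableSet.iInter fun l =>
      (measurableSet_le (by fun_prop) (by fun_prop)).inter
        (measurableSet_le (by fun_prop) (by fun_prop))
  set F : (Fin k → ℝ) → ℝ → ENNReal := fun β σ =>
    B.indicator (fun p => ENNReal.ofReal ((τ * p.2 / 2) ^ r * (p.2⁻¹) ^ n)) (β, σ) with hF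
  have hFm : Measurable (Function.uncurry F) := Measurable.indicator (by fun_prop) hBm
  set G : ℝ × ℝ → ENNReal := fun g => ENNReal.ofReal (ctptLower g.1 g.2 ^ n) with hG
  have hGm : Measurable G := (measurable_ctptLower.pow_const n).ennreal_ofReal
  have hle : ∀ᵐ θ ∂(ctptPrior k Pγ Pν), F θ.1 θ.2.1 * G θ.2.2 ≤
      ENNReal.ofReal (|θ.1 j| ^ r * ctptLikelihood X y θ) := by
    filter_upwards [ae_ctptPrior hab hν.ae_gt] with θ hθ
    obtain ⟨β, σ, γ, ν⟩ := θ
    obtain ⟨hσ, hg, h2⟩ := hθ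
    simp only at hσ hg h2
    have hγ0 : 0 < γ := ha.trans_le hg.1
    by_cases hmem : (β, σ) ∈ B
    swap
    · simp [hF, hmem]
    obtain ⟨hσM, hβ⟩ := hmem
    simp only at hσM hβ
    have hres : ∀ i, |(y i - X.mulVec β i) / σ| ≤ 1 := by
      intro i
      rw [abs_div, abs_of_pos hσ, div_le_one hσ]
      have h1 : |y i| ≤ M := Finset.single_le_sum (f := fun i => |y i|)
        (fun _ _ => abs_nonneg _) (Finset.mem_univ i)
      have h3 : |X.mulVec β i| ≤ T * (τ * σ) := by
        have h4 : |X.mulVec β i| ≤ ∑ l, |X i l| * (τ * σ) := by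
          unfold Matrix.mulVec dotProduct
          refine (Finset.abs_sum_le_sum_abs _ _).trans (Finset.sum_le_sum fun l _ => ?_)
          rw [abs_mul]
          refine mul_le_mul_of_nonneg_left ?_ (abs_nonneg _)
          rw [abs_of_nonneg (le_trans (by positivity) (hβ l).1)]
          exact (hβ l).2
        refine h4.trans ?_
        rw [← Finset.sum_mul]
        refine mul_le_mul_of_nonneg_right ?_ (by positivity)
        exact Finset.single_le_sum (f := fun i => ∑ l, |X i l|)
          (fun _ _ => Finset.sum_nonneg fun _ _ => abs_nonneg _) (Finset.mem_univ i)
      have h5 : T * (τ * σ) ≤ 1 / 2 * σ := by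
        rw [← mul_assoc]; exact mul_le_mul_of_nonneg_right hTτ hσ.le
      have := abs_sub (y i) (X.mulVec β i)
      linarith
    simp only [hF, hG]
    rw [indicator_of_mem (show (β, σ) ∈ B from ⟨hσM, hβ⟩), ← ENNReal.ofReal_mul (by positivity)]
    refine ENNReal.ofReal_le_ofReal ?_
    have hL : (σ⁻¹) ^ n * ctptLower γ ν ^ n ≤ ctptLikelihood X y (β, σ, γ, ν) := by
      rw [← mul_pow]
      have : (σ⁻¹ * ctptLower γ ν) ^ n = ∏ _i : Fin n, (σ⁻¹ * ctptLower γ ν) := by simp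
      rw [this]
      refine Finset.prod_le_prod (fun _ _ => mul_nonneg (by positivity)
        (ctptLower_pos hγ0 (by linarith)).le) fun i _ => ?_
      exact mul_le_mul_of_nonneg_left (ctptLower_le hγ0 (by linarith) (hres i)) (by positivity)
    have hlow := (ctptLower_pos hγ0 (by linarith : 0 < ν)).le
    rw [mul_assoc]
    refine mul_le_mul (Real.rpow_le_rpow (by positivity) ((hβ j).1.trans (le_abs_self _)) hr0) hL
      (by positivity) (by positivity)
  rw [eq_top_iff]
  refine le_trans ?_ (lintegral_mono_ae hle)
  rw [lintegral_ctptPrior_mul Pγ Pν hFm hGm]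
  have hGpos : ∫⁻ g, G g ∂(Pγ.prod Pν) ≠ 0 := by
    intro h
    rw [lintegral_eq_zero_iff hGm] at h
    have h1 : ∀ᵐ g ∂(Pγ.prod Pν), g.1 ∈ Icc a b ∧ 2 < g.2 :=
      (Measure.quasiMeasurePreserving_fst.ae hab).and
        (Measure.quasiMeasurePreserving_snd.ae hν.ae_gt)
    obtain ⟨g, hg0, hg1, hg2⟩ := (h.and h1).exists
    have hpos := pow_pos (ctptLower_pos (ha.trans_le hg1.1) (by linarith : 0 < g.2)) n
    simp only [hG, Pi.zero_apply, ENNReal.ofReal_eq_zero] at hg0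
    linarith
  have hinner : ∀ σ, 2 * M + 1 < σ → ENNReal.ofReal ((τ / 2) ^ (r + k)) * ENNReal.ofReal σ⁻¹ ≤
      ENNReal.ofReal σ⁻¹ * ∫⁻ β, F β σ := by
    intro σ hσM
    have hσ1 : 1 ≤ σ := by linarith
    have hσ : 0 < σ := by linarith
    have hFσ : ∀ β, F β σ = (Icc (fun _ => τ * σ / 2) fun _ => τ * σ).indicator
        (fun _ => ENNReal.ofReal ((τ * σ / 2) ^ r * (σ⁻¹) ^ n)) β := by
      intro β
      simp only [hF, indicator]
      congr 1
      simp [hB, hσM, Pi.le_def, forall_and]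
    simp_rw [hFσ]
    rw [lintegral_indicator_const measurableSet_Icc, Real.volume_Icc_pi,
      mul_comm (ENNReal.ofReal ((τ / 2) ^ (r + k)))]
    refine mul_le_mul_right ?_ _
    rw [show ∏ _i : Fin k, ENNReal.ofReal (τ * σ - τ * σ / 2) =
      ENNReal.ofReal ((τ * σ / 2) ^ k) by
        rw [Finset.prod_const, Finset.card_univ, Fintype.card_fin,
          ENNReal.ofReal_pow (by positivity)]; congr 2; ring,
      ← ENNReal.ofReal_mul (by positivity)]
    refine ENNReal.ofReal_le_ofReal ?_
    -- Moment, likelihood and volume of the `β`-box combine to `σ ^ (r + k - n) ≥ 1`, leaving the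
    -- divergent `dσ / σ`.
    have h1 : (τ * σ / 2) ^ r * (σ⁻¹) ^ n * (τ * σ / 2) ^ k =
        (τ / 2) ^ (r + k) * σ ^ (r + k - n) := by
      rw [show τ * σ / 2 = τ / 2 * σ by ring, Real.mul_rpow (by positivity) hσ.le, mul_pow,
        Real.rpow_add (by positivity), Real.rpow_sub hσ, Real.rpow_add hσ]
      simp only [Real.rpow_natCast, inv_pow]
      field_simp
    rw [h1]
    exact le_mul_of_one_le_right (by positivity) (Real.one_le_rpow hσ1 (by linarith))
  have htop : ∫⁻ σ in Ioi (2 * M + 1), ENNReal.ofReal σ⁻¹ = ⊤ := by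
    by_contra h
    refine not_integrableOn_Ioi_inv (a := 2 * M + 1) ⟨by fun_prop, ?_⟩
    rw [hasFiniteIntegral_iff_ofReal]
    · exact lt_top_iff_ne_top.2 h
    · filter_upwards [ae_restrict_mem measurableSet_Ioi] with σ hσ
      have : 2 * M + 1 < σ := hσ
      have : 0 < σ := by linarith
      simp [this.le]
  have hσtop : ∫⁻ σ in Ioi 0, ENNReal.ofReal σ⁻¹ * ∫⁻ β, F β σ = ⊤ := by
    rw [eq_top_iff]
    calc ⊤ = ∫⁻ σ in Ioi (2 * M + 1),
          ENNReal.ofReal ((τ / 2) ^ (r + k)) * ENNReal.ofReal σ⁻¹ := by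
          rw [lintegral_const_mul' _ _ ENNReal.ofReal_ne_top, htop, ENNReal.mul_top]
          simp only [ne_eq, ENNReal.ofReal_eq_zero, not_le]
          positivity
      _ ≤ ∫⁻ σ in Ioi (2 * M + 1), ENNReal.ofReal σ⁻¹ * ∫⁻ β, F β σ :=
          setLIntegral_mono' measurableSet_Ioi fun σ hσ => hinner σ hσ
      _ ≤ _ := lintegral_mono_set (Ioi_subset_Ioi (by positivity))
  rw [hσtop, ENNReal.top_mul hGpos]

theorem theorem4 {n k : ℕ} (X : Matrix (Fin n) (Fin k) ℝ) (hX : X.rank = k) :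
    (∀ y : Fin n → ℝ, (¬ ∃ β : Fin k → ℝ, X.mulVec β = y) →
      ∀ Pγ Pν : Measure ℝ, IsSkewnessPrior Pγ → IsTailPrior Pν → PosteriorProper X y Pγ Pν →
        ∀ (j : Fin k) (r : ℝ), (n : ℝ) - k ≤ r → posteriorAbsMoment X y Pγ Pν j r = ⊤) ∧
    (∀ᵐ y : Fin n → ℝ, (¬ ∃ β : Fin k → ℝ, X.mulVec β = y) →
      ∀ Pγ Pν : Measure ℝ, IsSkewnessPrior Pγ → IsTailPrior Pν →
        PosteriorProper X y Pγ Pν ∧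
        ∀ (j : Fin k) (r : ℝ), 0 ≤ r →
          r < min ((n : ℝ) - k) ((n : ℝ) - k - singularityIndex X j + 2) →
          posteriorAbsMoment X y Pγ Pν j r < ⊤) := by
  refine ⟨fun y _ Pγ Pν hγ hν hproper j r hr => ?_, ?_⟩
  · have hkn : (k : ℝ) ≤ n := by
      have : k ≤ n := by rw [← hX]; exact X.rank_le_height
      exact_mod_cast this
    -- A finite normalising constant has nonzero inverse, so the product with `⊤` remains `⊤`.
    rw [posteriorAbsMoment_eq, lintegral_moment_mul_ctptLikelihood_eq_top X y hγ hν j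
      (by linarith) hr, ENNReal.mul_top (ENNReal.inv_ne_zero.2 hproper.2.ne)]
  · filter_upwards [ae_powerTailIntegral_moment_lt_top hX] with y hy hyX Pγ Pν hγ hν
    obtain ⟨h0, hmom⟩ := hy hyX
    have hpos := marginalLikelihood_pos X y hγ hν
    refine ⟨⟨hpos, ?_⟩, fun j r hr0 hr => ?_⟩
    · have h := lintegral_mul_ctptLikelihood_lt_top X y hγ hν (fun _ => zero_le_one)
        measurable_const h0
      simpa [marginalLikelihood] using h
    · rw [posteriorAbsMoment_eq]
      exact ENNReal.mul_lt_top (ENNReal.inv_lt_top.2 hpos)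
        (lintegral_mul_ctptLikelihood_lt_top X y hγ hν (fun b => by positivity) (by fun_prop)
          (hmom j r hr0 hr))
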